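/- **Setting.** Let $U$ be a finite universe of size $N$. A dataset is $x=(x_1,\dots,x_n)\in U^n$; two datasets are neighbouring if they differ in exactly one entry. A Boolean statistical query is $q:U\to\{0,1\}$, with $q(x)=\frac1n\sum_{i}q(x_i)$; for $\mathcal Q=(q_1,\dots,q_m)$ put $\mathcal Q(x)=(q_1(x),\dots,q_m(x))$, and let $Q\in\{0,1\}^{m\times U}$ be the matrix whose rows are the truth tables of the $q_j$. A randomized algorithm $M$ on $U^n$ is $(\varepsilon,\delta)$-differentially private (DP) if $\Pr[M(x)\in R]\le e^{\varepsilon}\Pr[M(x')\in R]+\delta$ for all neighbouring $x,x'$ and all measurable $R$. An interactive algorithm receives $x$ and then, in rounds $j=1,\dots,m$, receives a query $q_j$ and returns an answer $a_j\in\mathbb R$; an adaptive analyst chooses $q_j$, possibly at random, from the previous queries and answers. The interactive algorithm is $(\varepsilon,\delta)$-DP if for every adaptive analyst the transcript $(q_1,a_1,\dots,q_m,a_m)$ is an $(\varepsilon,\delta)$-DP function of $x$. For a matrix $B$ with columns indexed by $U$ let $$\mathrm{hdisc}(B,w)=\max_{S\subseteq U,\ |S|\le w}\ \min_{z\in\{\pm1\}^S}\|B_S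 z\|_\infty ,$$ and let $\mathrm{hdisc}^*(\mathcal Q,w)=\mathrm{hdisc}(Q^*,w)$, where $Q^*$ is $Q$ with the row $(1,\dots,1)$ appended. All logarithms are natural. Put $$F(\mathcal Q)=\frac{\sqrt{\mathrm{hdisc}^*(\mathcal Q,n)\,\log N\,\log(1/\delta)}\;\log\!\left(\frac{m\log n}{\beta}\right)\log n}{\varepsilon n}.$$ **Theorem.** (1) There is an absolute constant $k$, and for every $\delta_0\in(0,1)$ a constant $C>0$ depending only on $\delta_0$, such that for every finite $U$ and all $n\ge3$, $m\ge1$, $\varepsilon\in(0,1]$, $\delta\in(0,\delta_0]$, $\beta\in(0,1)$ there is an $(\varepsilon,\delta)$-differentially private interactive algorithm such that, for every dataset $x\in U^n$ and every adaptive analyst asking $m$ Boolean statistical queries, the queries $\mathcal Q=(q_1,\dots,q_m)$ asked and the answers $a=(a_1,\dots,a_m)$ satisfy, with probability at least $1-\beta$, $$\|\mathcal Q(x)-a\|_\infty\ \le\ C\,(1+\log\log n)^k\,F(\mathcal Q)^{2/3}.$$ (2) This is competitive with the offline discrepancy lower bound in the following sense. There is an absolute constant $c>0$ such that for every finite $U$,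 all $n\ge3$, $m\ge1$ and every sequence $\mathcal Q$ of $m$ Boolean statistical queries with $H:=\mathrm{hdisc}^*(\mathcal Q,n)\ge2$: for every $(\frac18,\frac18)$-differentially private (offline) algorithm $M_{\mathcal Q}:U^n\to\mathbb R^m$ there is a dataset $x\in U^n$ with $$\mathbb E\,\|\mathcal Q(x)-M_{\mathcal Q}(x)\|_\infty\ \ge\ c\,\frac{H}{n\log n},$$ and for all $\varepsilon>0$ and $\delta,\beta\in(0,1)$, $$\frac{H}{n}=F(\mathcal Q)^{2/3}\left(\frac{\varepsilon^2H^2}{n\,\log N\,\log(1/\delta)\,\log^2(\frac{m\log n}{\beta})\,\log^2 n}\right)^{1/3}.$$ -/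

import Mathlib

open MeasureTheory ProbabilityTheory

universe u

namespace OnlineRelease

noncomputable section

/-! ### Datasets, counting queries and differential privacy -/

/-- A dataset of `n` elements of the universe `U`. -/
abbrev Dataset (U : Type u) (n : ℕ) : Type u := Fin n → U

/-- A Boolean statistical query (a counting query). -/
abbrev BoolQuery (U : Type u) : Type u := U → Bool

/-- The entry `q u ∈ {0, 1}` of the truth table of `q`, as a real number. -/
def truth {U : Type u} (q : BoolQuery U) (u : U) : ℝ := if q u then 1 else 0

/-- `q(x) = (1/n) ∑ i, q(x i)`. -/
def queryValue {U : Type u} {n : ℕ} (q : BoolQuery U) (x : Dataset U n) : ℝ :=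
  (∑ i, truth q (x i)) / n

/-- Two datasets are neighbouring if they differ in exactly one data point. -/
def Neighboring {U : Type u} {n : ℕ} (x x' : Dataset U n) : Prop :=
  ∃ i, x i ≠ x' i ∧ ∀ j, j ≠ i → x j = x' j

/-- `(ε, δ)`-differential privacy of a randomized algorithm, given by its output laws. -/
def IsDP {U : Type u} {n : ℕ} {R : Type*} [MeasurableSpace R] (ε δ : ℝ)
    (M : Dataset U n → Measure R) : Prop :=
  ∀ x x' : Dataset U n, Neighboring x x' → ∀ s : Set R, MeasurableSet s →
    M x s ≤ ENNReal.ofReal (Real.exp ε) * M x' s + ENNReal.ofReal δ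

/-! ### Interactive algorithms, adaptive analysts, transcripts -/

/-- An interactive algorithm: it draws an initial internal state from the dataset, and on each
query it draws, from its current state and the query, a new state and a real answer. -/
structure InteractiveAlgorithm (U : Type u) (n : ℕ) where
  State : Type u
  [measurableSpace : MeasurableSpace State]
  init : Dataset U n → Measure State
  [init_prob : ∀ x, IsProbabilityMeasure (init x)]
  answer : Kernel (State × BoolQuery U) (State × ℝ)
  [answer_markov : IsMarkovKernel answer]

attribute [instance] InteractiveAlgorithm.measurableSpace InteractiveAlgorithm.init_prob
  InteractiveAlgorithm.answer_markov

/-- The record of the first `j` rounds: the queries asked, each with its answer. -/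
abbrev Transcript (U : Type u) (j : ℕ) : Type u := Fin j → BoolQuery U × ℝ

/-- An adaptive, possibly randomized, data analyst: the law of the next query is any measurable
function of the record of the previous rounds. -/
structure AdaptiveAnalyst (U : Type u) where
  next : ∀ j : ℕ, Kernel (Transcript U j) (BoolQuery U)
  [next_markov : ∀ j, IsMarkovKernel (next j)]

attribute [instance] AdaptiveAnalyst.next_markov

/-- Joint law, after `j` rounds on the dataset `x`, of the internal state of `M` and of the
record of the interaction between `M` and `A`. In each round the analyst draws a query from the
record, the algorithm draws an answer (and its new state), and both are appended. -/
def run {U : Type u} {n : ℕ} (M : InteractiveAlgorithm U n) (A : AdaptiveAnalyst U)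
    (x : Dataset U n) : ∀ j : ℕ, Measure (M.State × Transcript U j)
  | 0 => (M.init x).map (fun s => (s, Fin.elim0))
  | j + 1 =>
      ((run M A x j ⊗ₘ (A.next j).comap Prod.snd measurable_snd) ⊗ₘ
        M.answer.comap
          (fun p : (M.State × Transcript U j) × BoolQuery U => (p.1.1, p.2))
          (by fun_prop)).map
        (fun p => (p.2.1, Fin.snoc p.1.1.2 (p.1.2, p.2.2)))

/-- The law of the transcript of `m` rounds of interaction between `M` and `A` on `x`. -/
def trans {U : Type u} {n : ℕ} (M : InteractiveAlgorithm U n) (A : AdaptiveAnalyst U)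
    (m : ℕ) (x : Dataset U n) : Measure (Transcript U m) :=
  (run M A x m).map Prod.snd

/-- `M` is `(ε, δ)`-differentially private, for `m` queries and adaptive analysts. -/
def InteractiveAlgorithm.IsPrivate {U : Type u} {n : ℕ} (M : InteractiveAlgorithm U n)
    (m : ℕ) (ε δ : ℝ) : Prop :=
  ∀ A : AdaptiveAnalyst U, IsDP ε δ (trans M A m)

/-- The `ℓ_∞` error `‖Q(x) - a‖_∞` of answers `a` to the queries `Q` on the dataset `x`
(the norm on `Fin m → ℝ` is the maximum norm). -/
def maxError {U : Type u} {n m : ℕ} (Q : Fin m → BoolQuery U) (a : Fin m → ℝ)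
    (x : Dataset U n) : ℝ :=
  ‖fun j => queryValue (Q j) x - a j‖

/-! ### Hereditary discrepancy -/

/-- The query matrix, whose rows are the truth tables of the queries. -/
def queryMatrix {U : Type u} {m : ℕ} (Q : Fin m → BoolQuery U) : Matrix (Fin m) U ℝ :=
  Matrix.of fun j u => truth (Q j) u

/-- Restricted hereditary discrepancy: the maximum over sets `S` of at most `w` columns of the
minimum over `x ∈ {±1}^S` of `‖Q_S x‖_∞`. -/
def hdisc {U : Type u} {k : ℕ} (Q : Matrix (Fin k) U ℝ) (w : ℕ) : ℝ :=
  ⨆ S : {S : Finset U // S.card ≤ w}, ⨅ x : S.1 → ℤˣ,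
    ‖(Q.submatrix id (Subtype.val : S.1 → U)).mulVec (fun v => (((x v : ℤˣ) : ℤ) : ℝ))‖

/-- The matrix `Q*`: `Q` with the row `(1, …, 1)` appended. -/
def appendOnes {U : Type u} {k : ℕ} (Q : Matrix (Fin k) U ℝ) : Matrix (Fin (k + 1)) U ℝ :=
  Matrix.of (Fin.snoc (α := fun _ => U → ℝ) (fun j => Q j) (fun _ => 1))

/-- Modified restricted hereditary discrepancy `hdisc*(Q, w) = hdisc(Q*, w)` of a sequence of
counting queries. -/
def hdiscStar {U : Type u} {m : ℕ} (Q : Fin m → BoolQuery U) (w : ℕ) : ℝ :=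
  hdisc (appendOnes (queryMatrix Q)) w

/-! ### The error rate -/

/-- `√(H log N log(1/δ)) · log(m log n / β) · log n / (ε n)`. -/
def errorRate (H : ℝ) (N n m : ℕ) (ε δ β : ℝ) : ℝ :=
  Real.sqrt (H * Real.log N * Real.log (1 / δ)) * Real.log (m * Real.log n / β) * Real.log n
    / (ε * n)

end

end OnlineRelease

/-! Upper bound. A dataset can be halved: give the elements of odd multiplicity the signs of a
low-discrepancy colouring and halve all multiplicities. After `d` halvings roughly `n / 2^d` points
of weight `2^d` reproduce every count up to `2^d H`, and the row of ones controls the size of the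
summary (`exists_summary`). So at stage `k` it suffices to consider multisets of size at most
`2^(k+1)`, whose number has logarithm of order `2^k log N`.

The mechanism `halving` does not know `H`. It predicts each count by the median over the hypotheses
still alive, and publishes a noisy count only when the prediction is noticeably wrong. Such a
publication kills at least half of the hypotheses (`two_mul_card_near_le`) and spares the accurate
ones, so stage `k` sees `O(2^k log N)` of them. If the hypotheses run out, none of the stage was
accurate, and the next stage starts with more hypotheses and more noise. Unless some noise is
excessive, the stage never passes the first one containing an accurate hypothesis (`Invariant`,
`halving_accurate`).

Privacy is that of the sparse vector technique. A hidden geometric counter acts as threshold noise,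
and shifting it by one absorbs a change of one data point, so that predictions are free and only
publications are paid for. Payments are composed through moments of the likelihood ratio
(`sum_ratioMoment_le`), which yields a tolerance at stage `k` proportional to `√(2^k log N log(1/δ))
/ ε`, up to logarithms.

The rate comes from a balance. If stage `k` has no accurate hypothesis, its relative tolerance `μ`,
capped at 1, satisfies `2^k μ ≤ 2H` (`exists_fits`). Since also `μ² ≤ K 2^k F² / H`, it follows that
`μ³ ≤ 2 K F²`, whence the exponent `2/3` (`error_le_of_stage`).

Lower bound. If every set of columns had a good partial colouring of an eighth of its elements,
iterating `O(log n)` times would colour everything too well. So there is a set `S` on which each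
large partial colouring has discrepancy of order `H / log n` (`exists_rigid_set`). Pair up `S` and
encode a bit string by choosing one element of each pair. Strings far apart give datasets whose
difference is a large partial colouring, so accurate answers would reconstruct most bits, which
privacy forbids (`exists_reconstruction_error`). The final identity is algebra. -/

open scoped ENNReal

namespace OnlineRelease

noncomputable section

/-! ### Laws of discrete random variables -/

/-- The law of `f a` for `a` drawn from `p`. -/
def pushLaw {α β : Type*} [MeasurableSpace β] (p : PMF α) (f : α → β) : Measure β :=
  letI : MeasurableSpace α := ⊤
  p.toMeasure.map f

theorem lintegral_pushLaw {α β : Type*} [Countable α] [MeasurableSpace β] (p : PMF α)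
    (f : α → β) {ψ : β → ℝ≥0∞} (hψ : Measurable ψ) :
    ∫⁻ b, ψ b ∂(pushLaw p f) = ∑' a, p a * ψ (f a) := by
  let _ : MeasurableSpace α := ⊤
  have hf : Measurable f := measurable_from_top
  rw [pushLaw, lintegral_map hψ hf, lintegral_countable']
  refine tsum_congr fun a => ?_
  rw [PMF.toMeasure_apply_singleton _ _ MeasurableSpace.measurableSet_top, mul_comm]

instance {α β : Type*} [MeasurableSpace β] (p : PMF α) (f : α → β) :
    IsProbabilityMeasure (pushLaw p f) := by
  let _ : MeasurableSpace α := ⊤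
  exact Measure.isProbabilityMeasure_map (measurable_from_top (f := f)).aemeasurable

/-! ### Mechanisms with a public state and a hidden counter -/

/-- A mechanism with a public state, updated when the outcome of a round is `some z`, and a hidden
counter, drawn afresh at the same times. -/
structure SparseMechanism (U : Type u) (n : ℕ) (Pub : Type u) where
  start : Pub
  fresh : Pub → PMF ℕ
  outcome : Dataset U n → Pub → BoolQuery U → ℕ → PMF (Option (Fin (n + 1)))
  next : Pub → BoolQuery U → Fin (n + 1) → Pub
  reply : Pub → BoolQuery U → Option (Fin (n + 1)) → ℝ

/-- The queries and outcomes of the first `j` rounds. -/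
def Hist (U : Type u) (n : ℕ) : ℕ → Type u
  | 0 => PUnit
  | j + 1 => Hist U n j × BoolQuery U × Option (Fin (n + 1))

instance instFintypeHist {U : Type u} [Fintype U] [DecidableEq U] {n : ℕ} :
    ∀ j, Fintype (Hist U n j)
  | 0 => inferInstanceAs (Fintype PUnit)
  | j + 1 =>
    letI := instFintypeHist (U := U) (n := n) j
    inferInstanceAs (Fintype (Hist U n j × BoolQuery U × Option (Fin (n + 1))))

/-- The empty history. -/
def emptyHist (U : Type u) (n : ℕ) : Hist U n 0 := PUnit.unit

theorem sum_hist_zero {U : Type u} [Fintype U] [DecidableEq U] {n : ℕ} {β : Type*}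
    [AddCommMonoid β] (f : Hist U n 0 → β) : ∑ h, f h = f (emptyHist U n) :=
  Fintype.sum_unique (ι := PUnit) f

theorem sum_hist_succ {U : Type u} [Fintype U] [DecidableEq U] {n j : ℕ} {β : Type*}
    [AddCommMonoid β] (f : Hist U n (j + 1) → β) :
    ∑ h, f h = ∑ h : Hist U n j, ∑ q : BoolQuery U, ∑ o : Option (Fin (n + 1)), f (h, q, o) := by
  have := Fintype.sum_prod_type (fun h : Hist U n j × BoolQuery U × Option (Fin (n + 1)) => f h)
  refine Eq.trans this ?_
  exact Finset.sum_congr rfl fun h _ => Fintype.sum_prod_type _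

namespace SparseMechanism

variable {U : Type u} {n : ℕ} {Pub : Type u} (M : SparseMechanism U n Pub)

/-- The public state after a round. -/
def move (σ : Pub) (q : BoolQuery U) (o : Option (Fin (n + 1))) : Pub := o.elim σ (M.next σ q)

/-- The law of the hidden counter after a round. -/
def refresh (σ : Pub) (q : BoolQuery U) (r : ℕ) (o : Option (Fin (n + 1))) : PMF ℕ :=
  o.elim (PMF.pure r) fun z => M.fresh (M.next σ q z)

/-- One round: the outcome and the new counter. -/
def step (x : Dataset U n) (σ : Pub) (q : BoolQuery U) (r : ℕ) :
    PMF (Option (Fin (n + 1)) × ℕ) :=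
  (M.outcome x σ q r).bind fun o => (M.refresh σ q r o).map (Prod.mk o)

theorem step_apply (x : Dataset U n) (σ : Pub) (q : BoolQuery U) (r : ℕ)
    (o : Option (Fin (n + 1))) (r' : ℕ) :
    M.step x σ q r (o, r') = M.outcome x σ q r o * M.refresh σ q r o r' := by
  classical
  rw [step, PMF.bind_apply, tsum_eq_single o]
  · congr 1
    rw [PMF.map_apply, tsum_eq_single r']
    · simp
    · intro b hb
      simp [Ne.symm hb]
  · intro o' ho'
    rw [PMF.map_apply]
    simp [Ne.symm ho']

variable [Fintype U] [Countable Pub]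

/-- The interactive algorithm carried out by the mechanism. -/
def algorithm : InteractiveAlgorithm U n where
  State := Dataset U n × Pub × ℕ
  measurableSpace := ⊤
  init x := letI : MeasurableSpace (Dataset U n × Pub × ℕ) := ⊤
    pushLaw (M.fresh M.start) fun r => (x, M.start, r)
  init_prob x := inferInstance
  answer := letI : MeasurableSpace (Dataset U n × Pub × ℕ) := ⊤
    Kernel.ofFunOfCountable fun p =>
      pushLaw (M.step p.1.1 p.1.2.1 p.2 p.1.2.2) fun r =>
        ((p.1.1, M.move p.1.2.1 p.2 r.1, r.2), M.reply p.1.2.1 p.2 r.1)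
  answer_markov := letI : MeasurableSpace (Dataset U n × Pub × ℕ) := ⊤
    ⟨fun p => by
      change IsProbabilityMeasure (pushLaw _ _)
      infer_instance⟩

/-- The public state after the rounds of a history. -/
def pub : ∀ j, Hist U n j → Pub
  | 0, _ => M.start
  | j + 1, (h, q, o) => M.move (pub j h) q o

/-- The transcript of a history. -/
def record : ∀ j, Hist U n j → Transcript U j
  | 0, _ => Fin.elim0
  | j + 1, (h, q, o) => Fin.snoc (record j h) (q, M.reply (M.pub j h) q o)

/-- The joint law of the history and of the hidden counter. -/
def law (A : AdaptiveAnalyst U) (x : Dataset U n) : ∀ j, Hist U n j → ℕ → ℝ≥0∞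
  | 0, _, r => M.fresh M.start r
  | j + 1, (h, q, o), r' => ∑' r, law A x j h r *
      (A.next j (M.record j h) {q} * M.step x (M.pub j h) q r (o, r'))

end SparseMechanism

/-! ### One round of interaction as an iterated integral. -/

instance isProbabilityMeasure_run {U : Type u} {n : ℕ} (M : InteractiveAlgorithm U n)
    (A : AdaptiveAnalyst U) (x : Dataset U n) :
    ∀ j, IsProbabilityMeasure (run M A x j)
  | 0 => by
    rw [run]
    exact Measure.isProbabilityMeasure_map (by fun_prop)
  | j + 1 => by
    have := isProbabilityMeasure_run M A x j
    rw [run]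
    refine Measure.isProbabilityMeasure_map (Measurable.aemeasurable ?_)
    refine Measurable.prodMk (by fun_prop) ?_
    refine measurable_pi_iff.2 fun i => ?_
    refine Fin.lastCases ?_ (fun i => ?_) i
    · simp only [Fin.snoc_last]; fun_prop
    · simp only [Fin.snoc_castSucc]; fun_prop

theorem measurable_snoc_transcript {U : Type u} {j : ℕ} :
    Measurable fun p : Transcript U j × (BoolQuery U × ℝ) =>
      (Fin.snoc p.1 p.2 : Transcript U (j + 1)) := by
  refine measurable_pi_iff.2 fun i => ?_
  refine Fin.lastCases ?_ (fun i => ?_) i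
  · simp only [Fin.snoc_last]; fun_prop
  · simp only [Fin.snoc_castSucc]; fun_prop

theorem lintegral_run_succ {U : Type u} {n : ℕ} (M : InteractiveAlgorithm U n)
    (A : AdaptiveAnalyst U) (x : Dataset U n) (j : ℕ)
    {ψ : M.State × Transcript U (j + 1) → ℝ≥0∞} (hψ : Measurable ψ) :
    ∫⁻ p, ψ p ∂(run M A x (j + 1)) =
      ∫⁻ p, ∫⁻ q, ∫⁻ r, ψ (r.1, Fin.snoc p.2 (q, r.2)) ∂(M.answer (p.1, q))
        ∂(A.next j p.2) ∂(run M A x j) := by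
  have hs : Measurable fun p : ((M.State × Transcript U j) × BoolQuery U) × (M.State × ℝ) =>
      ((p.2.1, Fin.snoc p.1.1.2 (p.1.2, p.2.2)) : M.State × Transcript U (j + 1)) := by
    refine Measurable.prodMk (by fun_prop) ?_
    exact measurable_snoc_transcript.comp
      (g := fun p : Transcript U j × (BoolQuery U × ℝ) =>
        (Fin.snoc p.1 p.2 : Transcript U (j + 1)))
      (f := fun p : ((M.State × Transcript U j) × BoolQuery U) × (M.State × ℝ) =>
        (p.1.1.2, (p.1.2, p.2.2))) (by fun_prop)
  rw [run, lintegral_map hψ hs]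
  refine (Measure.lintegral_compProd (hψ.comp hs)).trans ?_
  exact Measure.lintegral_compProd (hψ.comp hs).lintegral_kernel_prod_right'

theorem measurable_lintegral_run_step {U : Type u} {n : ℕ} (M : InteractiveAlgorithm U n)
    (A : AdaptiveAnalyst U) (j : ℕ)
    {ψ : M.State × Transcript U (j + 1) → ℝ≥0∞} (hψ : Measurable ψ) :
    Measurable fun p : M.State × Transcript U j =>
      ∫⁻ q, ∫⁻ r, ψ (r.1, Fin.snoc p.2 (q, r.2)) ∂(M.answer (p.1, q)) ∂(A.next j p.2) := by
  have hs : Measurable fun p : ((M.State × Transcript U j) × BoolQuery U) × (M.State × ℝ) =>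
      ((p.2.1, Fin.snoc p.1.1.2 (p.1.2, p.2.2)) : M.State × Transcript U (j + 1)) := by
    refine Measurable.prodMk (by fun_prop) ?_
    exact measurable_snoc_transcript.comp
      (g := fun p : Transcript U j × (BoolQuery U × ℝ) =>
        (Fin.snoc p.1 p.2 : Transcript U (j + 1)))
      (f := fun p : ((M.State × Transcript U j) × BoolQuery U) × (M.State × ℝ) =>
        (p.1.1.2, (p.1.2, p.2.2))) (by fun_prop)
  have h1 := (hψ.comp hs).lintegral_kernel_prod_right' (κ := M.answer.comap
          (fun p : (M.State × Transcript U j) × BoolQuery U => (p.1.1, p.2))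
          (by fun_prop))
  exact h1.lintegral_kernel_prod_right' (κ := (A.next j).comap Prod.snd measurable_snd)

/-! ### Runs of a sparse mechanism as finite sums over histories. -/

namespace SparseMechanism

variable {U : Type u} {n : ℕ} {Pub : Type u} (M : SparseMechanism U n Pub)
  [Fintype U] [Countable Pub]

theorem lintegral_answer (x : Dataset U n) (σ : Pub) (q : BoolQuery U) (r : ℕ)
    {ψ : M.algorithm.State × ℝ → ℝ≥0∞} (hψ : Measurable ψ) :
    ∫⁻ p, ψ p ∂(M.algorithm.answer ((x, σ, r), q)) =
      ∑' p : Option (Fin (n + 1)) × ℕ, M.step x σ q r p *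
        ψ ((x, M.move σ q p.1, p.2), M.reply σ q p.1) :=
  lintegral_pushLaw _ _ hψ

/-- Queries and outcomes range over finite sets, and replies are determined by the public history.
Hence the real-valued transcript carries no more randomness than a history, and the measure theory
ends here. -/
theorem lintegral_run [DecidableEq U] (A : AdaptiveAnalyst U) (x : Dataset U n) :
    ∀ (j : ℕ) (ψ : M.algorithm.State × Transcript U j → ℝ≥0∞), Measurable ψ →
      ∫⁻ p, ψ p ∂(run M.algorithm A x j) =
        ∑ h : Hist U n j, ∑' r, M.law A x j h r * ψ ((x, M.pub j h, r), M.record j h)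
  | 0, ψ, hψ => by
    have h0 : Measurable fun s : M.algorithm.State =>
        ((s, Fin.elim0) : M.algorithm.State × Transcript U 0) := by fun_prop
    rw [run, lintegral_map hψ h0]
    refine (lintegral_pushLaw (M.fresh M.start) _ (hψ.comp h0)).trans ?_
    rw [sum_hist_zero]
    rfl
  | j + 1, ψ, hψ => by
    rw [lintegral_run_succ _ _ _ _ hψ,
      lintegral_run A x j _ (measurable_lintegral_run_step _ _ _ hψ), sum_hist_succ]
    refine Finset.sum_congr rfl fun h _ => ?_
    have key : ∀ r, M.law A x j h r *
        ∫⁻ q, ∫⁻ p, ψ (p.1, Fin.snoc (M.record j h) (q, p.2))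
          ∂(M.algorithm.answer ((x, M.pub j h, r), q)) ∂(A.next j (M.record j h)) =
        ∑ q : BoolQuery U, ∑ o : Option (Fin (n + 1)), ∑' r', M.law A x j h r *
          (A.next j (M.record j h) {q} * M.step x (M.pub j h) q r (o, r')) *
            ψ ((x, M.pub (j + 1) (h, q, o), r'), M.record (j + 1) (h, q, o)) := by
      intro r
      rw [lintegral_fintype, Finset.mul_sum]
      refine Finset.sum_congr rfl fun q _ => ?_
      have hm : Measurable fun p : M.algorithm.State × ℝ =>
          ψ (p.1, Fin.snoc (M.record j h) (q, p.2)) := by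
        refine hψ.comp (Measurable.prodMk (by fun_prop) ?_)
        exact measurable_snoc_transcript.comp
          (g := fun p : Transcript U j × (BoolQuery U × ℝ) =>
            (Fin.snoc p.1 p.2 : Transcript U (j + 1)))
          (f := fun p : M.algorithm.State × ℝ => (M.record j h, (q, p.2))) (by fun_prop)
      rw [M.lintegral_answer _ _ _ _ hm, ENNReal.tsum_prod', tsum_fintype, Finset.sum_mul,
        Finset.mul_sum]
      refine Finset.sum_congr rfl fun o _ => ?_
      rw [← ENNReal.tsum_mul_right, ← ENNReal.tsum_mul_left]
      refine tsum_congr fun r' => ?_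
      simp only [pub, record]
      ring
    refine (tsum_congr key).trans ?_
    rw [Summable.tsum_finsetSum (fun _ _ => ENNReal.summable)]
    refine Finset.sum_congr rfl fun q _ => ?_
    rw [Summable.tsum_finsetSum (fun _ _ => ENNReal.summable)]
    refine Finset.sum_congr rfl fun o _ => ?_
    rw [ENNReal.tsum_comm]
    refine tsum_congr fun r' => ?_
    rw [ENNReal.tsum_mul_right]
    rfl

theorem trans_apply [DecidableEq U] (A : AdaptiveAnalyst U) (x : Dataset U n) (j : ℕ)
    {s : Set (Transcript U j)} (hs : MeasurableSet s) :
    trans M.algorithm A j x s =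
      ∑ h : Hist U n j, (∑' r, M.law A x j h r) * s.indicator 1 (M.record j h) := by
  rw [trans, ← lintegral_indicator_one hs, lintegral_map (measurable_one.indicator hs)
    measurable_snd]
  refine (M.lintegral_run A x j _ ((measurable_one.indicator hs).comp measurable_snd)).trans ?_
  refine Finset.sum_congr rfl fun h _ => ?_
  simp only [Function.comp]
  exact ENNReal.tsum_mul_right

end SparseMechanism

end

noncomputable section

/-! ### Moments of likelihood ratios -/

/-- The contribution `y (y / z) ^ l` of an outcome to the `l`-th moment of the likelihood ratio. -/
def ratioMoment (l : ℕ) (y z : ℝ) : ℝ := y ^ (l + 1) / z ^ l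

theorem ratioMoment_mul (l : ℕ) (y z y' z' : ℝ) :
    ratioMoment l (y * y') (z * z') = ratioMoment l y z * ratioMoment l y' z' := by
  simp only [ratioMoment, mul_pow, mul_div_mul_comm]

theorem ratioMoment_nonneg (l : ℕ) {y z : ℝ} (hy : 0 ≤ y) (hz : 0 ≤ z) :
    0 ≤ ratioMoment l y z := by
  unfold ratioMoment; positivity

theorem ratioMoment_one (l : ℕ) : ratioMoment l 1 1 = 1 := by simp [ratioMoment]

/-- Markov's inequality for one outcome: where `y / z` exceeds `exp ε`, the factor `(y / z) ^ l` is
at least `exp (l ε)`. The assumption on `z = 0` is needed because division by zero makes the moment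
vanish there for `l > 0`. -/
theorem le_exp_mul_add_ratioMoment (l : ℕ) (ε : ℝ) {y z : ℝ} (hy : 0 ≤ y) (hz : 0 ≤ z)
    (h0 : z = 0 → y = 0) :
    y ≤ Real.exp ε * z + Real.exp (-(l * ε)) * ratioMoment l y z := by
  by_cases h : y ≤ Real.exp ε * z
  · have := ratioMoment_nonneg l hy hz
    have := Real.exp_pos (-(l * ε))
    nlinarith [mul_nonneg this.le (ratioMoment_nonneg l hy hz)]
  · push Not at h
    have hz' : 0 < z := lt_of_le_of_ne hz fun hz0 => by
      simp [h0 hz0.symm, ← hz0] at h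
    have hy' : 0 < y := lt_of_le_of_lt (by positivity) h
    have h1 : Real.exp (l * ε) * z ^ l ≤ y ^ l := by
      rw [Real.exp_nat_mul, ← mul_pow]
      exact pow_le_pow_left₀ (by positivity) h.le l
    have h2 : y ≤ Real.exp (-(l * ε)) * ratioMoment l y z := by
      rw [ratioMoment, Real.exp_neg, ← div_eq_inv_mul, div_div, le_div_iff₀ (by positivity),
        pow_succ']
      nlinarith
    have : 0 ≤ Real.exp ε * z := by positivity
    linarith

/-- With `r = y / z`, the map `r ↦ α r + β` is the chord of the convex function `r ^ (l + 1)` over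
`[exp (-η), exp η]`. Being linear in `y` and `z`, the bound can be summed over outcomes, and total
masses 1 leave `α + β`. -/
theorem exists_ratioMoment_le (l : ℕ) {η : ℝ} (hη : 0 < η) :
    ∃ α β : ℝ, α + β ≤ Real.exp ((l + 1) ^ 2 * η ^ 2 / 2) ∧
      ∀ y z : ℝ, 0 ≤ y → 0 ≤ z → y ≤ Real.exp η * z → z ≤ Real.exp η * y →
        ratioMoment l y z ≤ α * y + β * z := by
  set b := Real.exp η with hb
  set a := Real.exp (-η) with ha
  have hab : a * b = 1 := by rw [ha, hb, ← Real.exp_add]; simp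
  have hb1 : 1 < b := by simpa [hb] using hη
  have ha0 : 0 < a := Real.exp_pos _
  have ha1 : a < 1 := by simpa [ha] using hη
  have hba : 0 < b - a := by linarith
  set α := (b ^ (l + 1) - a ^ (l + 1)) / (b - a) with hα
  refine ⟨α, a ^ (l + 1) - α * a, ?_, ?_⟩
  -- The chord at `r = 1` equals `cosh ((l + 1/2) η) / cosh (η / 2)`, and `cosh t ≤ exp (t² / 2)`.
  · have h1 : α + (a ^ (l + 1) - α * a) = (a ^ (l + 1) * b + b ^ (l + 1)) / (b + 1) := by
      have hb0 : b ≠ 0 := by positivity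
      have hb2 : b + 1 ≠ 0 := by positivity
      have h3 : (1 - a) / (b - a) = 1 / (b + 1) := by
        rw [div_eq_div_iff hba.ne' hb2]
        nlinarith
      have h4 : (1 - a) * (b + 1) = b - a := by nlinarith
      rw [hα, eq_div_iff hb2]
      field_simp
      linear_combination (b ^ (l + 1) - a ^ (l + 1)) * h4
    rw [h1]
    have h2 : a ^ (l + 1) * b + b ^ (l + 1) =
        2 * Real.exp (η / 2) * Real.cosh ((l + 1 / 2) * η) := by
      rw [Real.cosh_eq, ha, hb, ← Real.exp_nat_mul, ← Real.exp_nat_mul, ← Real.exp_add]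
      have : Real.exp (η / 2) * Real.exp ((l + 1 / 2) * η) = Real.exp (((l + 1 : ℕ) : ℝ) * η) := by
        rw [← Real.exp_add]; congr 1; push_cast; ring
      have h' : Real.exp (η / 2) * Real.exp (-((l + 1 / 2) * η)) =
          Real.exp (((l + 1 : ℕ) : ℝ) * (-η) + η) := by
        rw [← Real.exp_add]; congr 1; push_cast; ring
      linear_combination -this - h'
    have h3 : b + 1 = 2 * Real.exp (η / 2) * Real.cosh (η / 2) := by
      have h' : Real.exp (η / 2) * Real.exp (-(η / 2)) = 1 := by rw [← Real.exp_add]; simp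
      have h'' : Real.exp (η / 2) * Real.exp (η / 2) = b := by
        rw [← Real.exp_add, hb]; congr 1; ring
      rw [Real.cosh_eq]
      linear_combination -h' - h''
    rw [h2, h3, mul_div_mul_left _ _ (by positivity)]
    calc Real.cosh ((l + 1 / 2) * η) / Real.cosh (η / 2)
        ≤ Real.cosh ((l + 1 / 2) * η) :=
          div_le_self (Real.cosh_pos _).le (Real.one_le_cosh _)
      _ ≤ Real.exp (((l + 1 / 2) * η) ^ 2 / 2) := Real.cosh_le_exp_half_sq _
      _ ≤ _ := by
        apply Real.exp_le_exp.2
        rw [mul_pow]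
        gcongr
        norm_num
  · intro y z hy hz hyz hzy
    rcases hz.eq_or_lt with rfl | hz
    · have : y = 0 := by linarith
      simp [this, ratioMoment]
    set r := y / z with hr
    have hy' : y = r * z := by rw [hr]; field_simp
    have hr1 : r ≤ b := by rw [hr, div_le_iff₀ hz]; exact hyz
    have hr2 : a ≤ r := by
      rw [hr, le_div_iff₀ hz]
      nlinarith
    have hconv := (convexOn_pow (𝕜 := ℝ) (l + 1)).2 (Set.mem_Ici.2 ha0.le)
      (Set.mem_Ici.2 (zero_lt_one.trans hb1).le)
      (div_nonneg (sub_nonneg.2 hr1) hba.le) (div_nonneg (sub_nonneg.2 hr2) hba.le) (by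
        rw [← add_div, div_eq_one_iff_eq hba.ne']; ring)
    simp only [smul_eq_mul] at hconv
    have e1 : (b - r) / (b - a) * a + (r - a) / (b - a) * b = r := by
      field_simp; ring
    have e2 : (b - r) / (b - a) * a ^ (l + 1) + (r - a) / (b - a) * b ^ (l + 1) =
        α * r + (a ^ (l + 1) - α * a) := by
      rw [hα]; field_simp; ring
    rw [e1, e2] at hconv
    have : ratioMoment l y z = z * r ^ (l + 1) := by
      rw [ratioMoment, hy', mul_pow, pow_succ z l]; field_simp
    rw [this, hy']
    nlinarith

/-! ### Privacy of sparse mechanisms by adaptive composition. -/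

namespace SparseMechanism

variable {U : Type u} {n : ℕ} {Pub : Type u} (M : SparseMechanism U n Pub)

/-- The likelihood of the outcomes since the last refresh, for each value of the counter. -/
def weight (x : Dataset U n) : ∀ j, Hist U n j → ℕ → ℝ≥0∞
  | 0, _, r => M.fresh M.start r
  | j + 1, (h, q, none), r => weight x j h r * M.outcome x (M.pub j h) q r none
  | j + 1, (h, q, some z), r => M.fresh (M.next (M.pub j h) q z) r

/-- The likelihood of the outcomes since the last refresh. -/
def segment (x : Dataset U n) (j : ℕ) (h : Hist U n j) : ℝ≥0∞ := ∑' r, M.weight x j h r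

/-- The likelihood of the outcomes since the last refresh and of one more outcome. -/
def extend (x : Dataset U n) (j : ℕ) (h : Hist U n j) (q : BoolQuery U)
    (o : Option (Fin (n + 1))) : ℝ≥0∞ :=
  ∑' r, M.weight x j h r * M.outcome x (M.pub j h) q r o

/-- The likelihood of the outcomes up to the last refresh. -/
def closed (x : Dataset U n) : ∀ j, Hist U n j → ℝ≥0∞
  | 0, _ => 1
  | j + 1, (h, _, none) => closed x j h
  | j + 1, (h, q, some z) => closed x j h * M.extend x j h q (some z)

/-- The probability with which the analyst asks the queries of a history. -/
def asked (A : AdaptiveAnalyst U) : ∀ j, Hist U n j → ℝ≥0∞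
  | 0, _ => 1
  | j + 1, (h, q, _) => asked A j h * A.next j (M.record j h) {q}

/-- The analyst's factor does not depend on the dataset, and the counter is redrawn at each refresh.
The likelihood therefore splits into independent segments, of which only the last involves the
current counter. -/
theorem law_eq (A : AdaptiveAnalyst U) (x : Dataset U n) :
    ∀ (j : ℕ) (h : Hist U n j) (r : ℕ),
      M.law A x j h r = M.asked A j h * M.closed x j h * M.weight x j h r
  | 0, _, r => by simp [law, asked, closed, weight]
  | j + 1, (h, q, none), r => by
    simp only [law, asked, closed, weight]
    rw [tsum_eq_single r]
    · rw [law_eq A x j h r, step_apply]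
      simp [refresh]
      ring
    · intro r' hr'
      rw [step_apply]
      simp [refresh, Ne.symm hr']
  | j + 1, (h, q, some z), r => by
    simp only [law, asked, closed, weight, extend]
    simp_rw [law_eq A x j h, step_apply, refresh, Option.elim_some]
    rw [← ENNReal.tsum_mul_left, ← ENNReal.tsum_mul_left, ← ENNReal.tsum_mul_right]
    refine tsum_congr fun r' => ?_
    ring

theorem tsum_law (A : AdaptiveAnalyst U) (x : Dataset U n) (j : ℕ) (h : Hist U n j) :
    ∑' r, M.law A x j h r = M.asked A j h * (M.closed x j h * M.segment x j h) := by
  simp_rw [law_eq, segment, ENNReal.tsum_mul_left, mul_assoc]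

theorem segment_none (x : Dataset U n) (j : ℕ) (h : Hist U n j) (q : BoolQuery U) :
    M.segment x (j + 1) (h, q, none) = M.extend x j h q none := rfl

theorem segment_some (x : Dataset U n) (j : ℕ) (h : Hist U n j) (q : BoolQuery U)
    (z : Fin (n + 1)) : M.segment x (j + 1) (h, q, some z) = 1 :=
  (M.fresh (M.next (M.pub j h) q z)).tsum_coe

theorem segment_zero (x : Dataset U n) (h : Hist U n 0) : M.segment x 0 h = 1 :=
  (M.fresh M.start).tsum_coe

theorem sum_extend (x : Dataset U n) (j : ℕ) (h : Hist U n j) (q : BoolQuery U) :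
    ∑ o, M.extend x j h q o = M.segment x j h := by
  unfold extend segment
  refine (Summable.tsum_finsetSum fun _ _ => ENNReal.summable).symm.trans ?_
  refine tsum_congr fun r => ?_
  rw [← Finset.mul_sum, ← tsum_fintype (L := .unconditional _), PMF.tsum_coe, mul_one]

theorem extend_le_segment (x : Dataset U n) (j : ℕ) (h : Hist U n j) (q : BoolQuery U)
    (o : Option (Fin (n + 1))) : M.extend x j h q o ≤ M.segment x j h := by
  rw [← M.sum_extend x j h q]
  exact Finset.single_le_sum (f := M.extend x j h q) (fun _ _ => zero_le) (Finset.mem_univ o)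

theorem segment_le_one (x : Dataset U n) : ∀ (j : ℕ) (h : Hist U n j), M.segment x j h ≤ 1
  | 0, h => (M.segment_zero x h).le
  | j + 1, (h, q, none) => (M.extend_le_segment x j h q none).trans (segment_le_one x j h)
  | j + 1, (h, q, some z) => (M.segment_some x j h q z).le

theorem extend_le_one (x : Dataset U n) (j : ℕ) (h : Hist U n j) (q : BoolQuery U)
    (o : Option (Fin (n + 1))) : M.extend x j h q o ≤ 1 :=
  (M.extend_le_segment x j h q o).trans (M.segment_le_one x j h)

theorem closed_le_one (x : Dataset U n) : ∀ (j : ℕ) (h : Hist U n j), M.closed x j h ≤ 1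
  | 0, _ => le_rfl
  | j + 1, (h, _, none) => closed_le_one x j h
  | j + 1, (h, q, some z) => mul_le_one' (closed_le_one x j h) (M.extend_le_one x j h q (some z))

theorem asked_le_one (A : AdaptiveAnalyst U) : ∀ (j : ℕ) (h : Hist U n j), M.asked A j h ≤ 1
  | 0, _ => le_rfl
  | j + 1, (h, _, _) => mul_le_one' (asked_le_one A j h) prob_le_one

/-- The behaviour on `x` is dominated by that on `x'` with the counter increased by one. -/
structure Dominated (e : Pub → ℝ) (x x' : Dataset U n) : Prop where
  fresh : ∀ σ r, M.fresh σ r ≤ ENNReal.ofReal (Real.exp (e σ)) * M.fresh σ (r + 1)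
  stay : ∀ σ q r, M.outcome x σ q r none ≤ M.outcome x' σ q (r + 1) none
  change : ∀ σ q r z, M.outcome x σ q r (some z) ≤
    ENNReal.ofReal (Real.exp (4 * e σ)) * M.outcome x' σ q (r + 1) (some z)

variable {M}

/-- The cost of shifting the counter is paid once, at the draw. Rounds with outcome `none` then add
nothing, however many there are. -/
theorem Dominated.weight_le {e : Pub → ℝ} {x x' : Dataset U n} (hd : M.Dominated e x x') :
    ∀ (j : ℕ) (h : Hist U n j) (r : ℕ),
      M.weight x j h r ≤ ENNReal.ofReal (Real.exp (e (M.pub j h))) * M.weight x' j h (r + 1)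
  | 0, _, r => hd.fresh _ r
  | j + 1, (h, q, none), r => by
    simp only [weight, ← mul_assoc]
    exact mul_le_mul' (hd.weight_le j h r) (hd.stay _ q r)
  | j + 1, (h, q, some z), r => hd.fresh _ r

theorem tsum_le_mul_tsum_of_shift {f g : ℕ → ℝ≥0∞} {c : ℝ≥0∞} (h : ∀ r, f r ≤ c * g (r + 1)) :
    ∑' r, f r ≤ c * ∑' r, g r :=
  calc ∑' r, f r ≤ ∑' r, c * g (r + 1) := ENNReal.tsum_le_tsum h
    _ = c * ∑' r, g (r + 1) := ENNReal.tsum_mul_left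
    _ ≤ c * ∑' r, g r :=
      mul_le_mul_right (ENNReal.tsum_comp_le_tsum_of_injective (add_left_injective 1) g) c

theorem Dominated.segment_le {e : Pub → ℝ} {x x' : Dataset U n} (hd : M.Dominated e x x')
    (j : ℕ) (h : Hist U n j) (he : 0 ≤ e (M.pub j h)) :
    M.segment x j h ≤ ENNReal.ofReal (Real.exp (5 * e (M.pub j h))) * M.segment x' j h := by
  refine (tsum_le_mul_tsum_of_shift (hd.weight_le j h)).trans ?_
  refine mul_le_mul_left (ENNReal.ofReal_le_ofReal (Real.exp_le_exp.2 (by linarith))) _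

theorem Dominated.extend_le {e : Pub → ℝ} {x x' : Dataset U n} (hd : M.Dominated e x x')
    (j : ℕ) (h : Hist U n j) (q : BoolQuery U) (z : Fin (n + 1)) :
    M.extend x j h q (some z) ≤
      ENNReal.ofReal (Real.exp (5 * e (M.pub j h))) * M.extend x' j h q (some z) := by
  refine tsum_le_mul_tsum_of_shift fun r => ?_
  refine (mul_le_mul' (hd.weight_le j h r) (hd.change _ q r z)).trans (le_of_eq ?_)
  rw [mul_mul_mul_comm, ← ENNReal.ofReal_mul (Real.exp_pos _).le, ← Real.exp_add]
  congr 4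
  ring

theorem toReal_le_of_le_ofReal_mul {a b : ℝ≥0∞} {c : ℝ} (hc : 0 ≤ c) (hb : b ≠ ⊤)
    (h : a ≤ ENNReal.ofReal c * b) : a.toReal ≤ c * b.toReal := by
  have := ENNReal.toReal_mono (ENNReal.mul_ne_top ENNReal.ofReal_ne_top hb) h
  rwa [ENNReal.toReal_mul, ENNReal.toReal_ofReal hc] at this

theorem ne_top_of_le_one {a : ℝ≥0∞} (h : a ≤ 1) : a ≠ ⊤ := ne_top_of_le_ne_top ENNReal.one_ne_top h

variable (M)

/-- A budget for a mechanism whose rounds are `e`-private: each change of the public state costs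
`(l + 1)² (5 e)² / 2` of it. -/
structure Budget (e : Pub → ℝ) (l : ℕ) (pot : Pub → ℝ) : Prop where
  pos : ∀ σ, 0 < e σ
  le : ∀ σ, (l + 1) ^ 2 * (5 * e σ) ^ 2 / 2 ≤ pot σ
  next : ∀ σ q z, pot (M.next σ q z) + (l + 1) ^ 2 * (5 * e σ) ^ 2 / 2 ≤ pot σ

variable {M} [Fintype U] [DecidableEq U]

/-- A supermartingale argument. The privacy of later segments depends on the history, so the
remaining budget is carried along as an exponential factor. -/
theorem sum_ratioMoment_le {e pot : Pub → ℝ} {l : ℕ} (hB : M.Budget e l pot)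
    {x x' : Dataset U n} (hd : M.Dominated e x x') (hd' : M.Dominated e x' x)
    (A : AdaptiveAnalyst U) (m : ℕ) :
    ∑ h : Hist U n m, (M.asked A m h).toReal *
      ratioMoment l (M.closed x m h * M.segment x m h).toReal
        (M.closed x' m h * M.segment x' m h).toReal ≤ Real.exp (pot M.start) := by
  choose α β hαβ hchord using fun σ =>
    exists_ratioMoment_le l (mul_pos (by norm_num : (0 : ℝ) < 5) (hB.pos σ))
  set b : Pub → ℝ := fun σ => (l + 1) ^ 2 * (5 * e σ) ^ 2 / 2 with hb
  have hseg : ∀ j h, ratioMoment l (M.segment x j h).toReal (M.segment x' j h).toReal ≤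
      α (M.pub j h) * (M.segment x j h).toReal + β (M.pub j h) * (M.segment x' j h).toReal := by
    intro j h
    refine hchord _ _ _ ENNReal.toReal_nonneg ENNReal.toReal_nonneg ?_ ?_
    · exact toReal_le_of_le_ofReal_mul (Real.exp_pos _).le
        (ne_top_of_le_one (M.segment_le_one x' j h)) (hd.segment_le j h (hB.pos _).le)
    · exact toReal_le_of_le_ofReal_mul (Real.exp_pos _).le
        (ne_top_of_le_one (M.segment_le_one x j h)) (hd'.segment_le j h (hB.pos _).le)
  have hext : ∀ j h q z, ratioMoment l (M.extend x j h q (some z)).toReal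
      (M.extend x' j h q (some z)).toReal ≤
      α (M.pub j h) * (M.extend x j h q (some z)).toReal +
        β (M.pub j h) * (M.extend x' j h q (some z)).toReal := by
    intro j h q z
    refine hchord _ _ _ ENNReal.toReal_nonneg ENNReal.toReal_nonneg ?_ ?_
    · exact toReal_le_of_le_ofReal_mul (Real.exp_pos _).le
        (ne_top_of_le_one (M.extend_le_one x' j h q _)) (hd.extend_le j h q z)
    · exact toReal_le_of_le_ofReal_mul (Real.exp_pos _).le
        (ne_top_of_le_one (M.extend_le_one x j h q _)) (hd'.extend_le j h q z)
  -- The potential takes the true moment for closed segments and the chord bound for the open one.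
  -- Linearity of the chord makes the sum over the next outcome exact. The exponential is the budget
  -- left once the open segment has been charged.
  set S : ∀ j, Hist U n j → ℝ := fun j h => (M.asked A j h).toReal *
    (ratioMoment l (M.closed x j h).toReal (M.closed x' j h).toReal *
      ((α (M.pub j h) * (M.segment x j h).toReal + β (M.pub j h) * (M.segment x' j h).toReal) *
        Real.exp (pot (M.pub j h) - b (M.pub j h)))) with hS
  have hclosed : ∀ j h, 0 ≤ ratioMoment l (M.closed x j h).toReal (M.closed x' j h).toReal :=
    fun j h => ratioMoment_nonneg l ENNReal.toReal_nonneg ENNReal.toReal_nonneg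
  have hround : ∀ j h q, ∑ o, S (j + 1) (h, q, o) ≤
      (A.next j (M.record j h) {q}).toReal * S j h := by
    intro j h q
    set w := (A.next j (M.record j h) {q}).toReal
    have hterm : ∀ o, S (j + 1) (h, q, o) ≤ w * ((M.asked A j h).toReal *
        (ratioMoment l (M.closed x j h).toReal (M.closed x' j h).toReal *
        ((α (M.pub j h) * (M.extend x j h q o).toReal +
          β (M.pub j h) * (M.extend x' j h q o).toReal) *
          Real.exp (pot (M.pub j h) - b (M.pub j h))))) := by
      rintro (_ | z)
      · apply le_of_eq
        simp only [hS, asked, closed, segment_none, pub, move, Option.elim_none,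
          ENNReal.toReal_mul]
        ring
      · set σ' := M.next (M.pub j h) q z with hσ'
        simp only [hS, asked, closed, segment_some, pub, move, Option.elim_some,
          ENNReal.toReal_mul, ratioMoment_mul, ENNReal.toReal_one, mul_one, ← hσ']
        -- A fresh segment has likelihood 1 under both datasets, so its chord bound is `α + β`; the
        -- drop of the potential pays for the segment just closed.
        have h1 : (α σ' + β σ') * Real.exp (pot σ' - b σ') ≤
            Real.exp (pot (M.pub j h) - b (M.pub j h)) := by
          calc (α σ' + β σ') * Real.exp (pot σ' - b σ')
              ≤ Real.exp (b σ') * Real.exp (pot σ' - b σ') := by gcongr; exact hαβ σ'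
            _ = Real.exp (pot σ') := by rw [← Real.exp_add]; ring_nf
            _ ≤ _ := Real.exp_le_exp.2 (le_sub_iff_add_le.2 (hB.next (M.pub j h) q z))
        have h2 := hext j h q z
        have h3 : 0 ≤ ratioMoment l (M.extend x j h q (some z)).toReal
            (M.extend x' j h q (some z)).toReal :=
          ratioMoment_nonneg l ENNReal.toReal_nonneg ENNReal.toReal_nonneg
        have h4 : ratioMoment l (M.extend x j h q (some z)).toReal
            (M.extend x' j h q (some z)).toReal * ((α σ' + β σ') * Real.exp (pot σ' - b σ')) ≤
            (α (M.pub j h) * (M.extend x j h q (some z)).toReal +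
              β (M.pub j h) * (M.extend x' j h q (some z)).toReal) *
              Real.exp (pot (M.pub j h) - b (M.pub j h)) :=
          (mul_le_mul_of_nonneg_left h1 h3).trans
            (mul_le_mul_of_nonneg_right h2 (Real.exp_pos _).le)
        have h5 := mul_le_mul_of_nonneg_left h4 (hclosed j h)
        have h6 := mul_le_mul_of_nonneg_left h5
          (mul_nonneg (ENNReal.toReal_nonneg (a := A.next j (M.record j h) {q}))
            (ENNReal.toReal_nonneg (a := M.asked A j h)))
        refine le_trans (le_of_eq ?_) (h6.trans (le_of_eq ?_)) <;> ring
    refine (Finset.sum_le_sum fun o _ => hterm o).trans (le_of_eq ?_)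
    rw [← Finset.mul_sum, ← Finset.mul_sum, ← Finset.mul_sum, ← Finset.sum_mul,
      Finset.sum_add_distrib, ← Finset.mul_sum, ← Finset.mul_sum,
      ← ENNReal.toReal_sum fun o _ => ne_top_of_le_one (M.extend_le_one x j h q o),
      ← ENNReal.toReal_sum fun o _ => ne_top_of_le_one (M.extend_le_one x' j h q o),
      M.sum_extend, M.sum_extend]
  have hsum : ∀ j, ∑ h, S j h ≤ Real.exp (pot M.start) := by
    intro j
    induction j with
    | zero =>
      rw [sum_hist_zero]
      simp only [hS, asked, closed, pub, ENNReal.toReal_one, ratioMoment_one, one_mul]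
      rw [M.segment_zero x, M.segment_zero x', ENNReal.toReal_one, mul_one, mul_one]
      calc (α M.start + β M.start) * Real.exp (pot M.start - b M.start)
          ≤ Real.exp (b M.start) * Real.exp (pot M.start - b M.start) := by
            gcongr; exact hαβ M.start
        _ = Real.exp (pot M.start) := by rw [← Real.exp_add]; ring_nf
    | succ j ih =>
      rw [sum_hist_succ]
      refine le_trans (Finset.sum_le_sum fun h _ => ?_) ih
      refine (Finset.sum_le_sum fun q _ => hround j h q).trans (le_of_eq ?_)
      rw [← Finset.sum_mul, ← ENNReal.toReal_sum fun q _ => measure_ne_top _ _,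
        sum_measure_singleton]
      simp
  refine le_trans (Finset.sum_le_sum fun h _ => ?_) (hsum m)
  rw [ENNReal.toReal_mul, ENNReal.toReal_mul, ratioMoment_mul]
  refine mul_le_mul_of_nonneg_left (mul_le_mul_of_nonneg_left ?_ (hclosed m h))
    ENNReal.toReal_nonneg
  have h1 : 1 ≤ Real.exp (pot (M.pub m h) - b (M.pub m h)) :=
    Real.one_le_exp (sub_nonneg.2 (hB.le (M.pub m h)))
  have h2 := hseg m h
  have h3 : 0 ≤ ratioMoment l (M.segment x m h).toReal (M.segment x' m h).toReal :=
    ratioMoment_nonneg l ENNReal.toReal_nonneg ENNReal.toReal_nonneg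
  nlinarith

theorem isPrivate [Countable Pub] {e pot : Pub → ℝ} {l : ℕ} {ε δ : ℝ} (hB : M.Budget e l pot)
    (hd : ∀ x x', Neighboring x x' → M.Dominated e x x')
    (hstart : Real.exp (pot M.start - l * ε) ≤ δ) (m : ℕ) :
    M.algorithm.IsPrivate m ε δ := by
  intro A x x' hx s hs
  have hx' : Neighboring x' x := by
    obtain ⟨i, hi, hj⟩ := hx
    exact ⟨i, hi.symm, fun j hji => (hj j hji).symm⟩
  rw [M.trans_apply A x m hs, M.trans_apply A x' m hs]
  set a : Hist U n m → ℝ := fun h => (M.asked A m h).toReal with ha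
  set p : Dataset U n → Hist U n m → ℝ := fun y h =>
    (M.closed y m h * M.segment y m h).toReal with hp
  have hp0 : ∀ y h, 0 ≤ p y h := fun y h => ENNReal.toReal_nonneg
  have ha0 : ∀ h, 0 ≤ a h := fun h => ENNReal.toReal_nonneg
  have hlaw : ∀ y h, ∑' r, M.law A y m h r = ENNReal.ofReal (a h * p y h) := by
    intro y h
    rw [tsum_law, ha, hp, ← ENNReal.toReal_mul, ENNReal.ofReal_toReal]
    exact ne_top_of_le_one (mul_le_one' (M.asked_le_one A m h)
      (mul_le_one' (M.closed_le_one y m h) (M.segment_le_one y m h)))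
  -- Absolute continuity, required by `le_exp_mul_add_ratioMoment`.
  have hclosed0 : ∀ (j : ℕ) (h : Hist U n j), M.closed x' j h = 0 → M.closed x j h = 0 := by
    intro j
    induction j with
    | zero => intro h h0; simp [closed] at h0
    | succ j ih =>
      rintro ⟨h, q, _ | z⟩ h0
      · exact ih h h0
      · simp only [closed, mul_eq_zero] at h0 ⊢
        refine h0.imp (ih h) fun h1 => ?_
        have := (hd x x' hx).extend_le j h q z
        rw [h1, mul_zero] at this
        exact le_antisymm this (zero_le)
  have hzero : ∀ h, p x' h = 0 → p x h = 0 := by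
    intro h h0
    have h1 : M.closed x' m h * M.segment x' m h = 0 := by
      refine ((ENNReal.toReal_eq_zero_iff _).1 h0).resolve_right (ne_top_of_le_one ?_)
      exact mul_le_one' (M.closed_le_one x' m h) (M.segment_le_one x' m h)
    have h2 : M.closed x m h * M.segment x m h = 0 := by
      rw [mul_eq_zero] at h1 ⊢
      refine h1.imp (hclosed0 m h) fun h2 => ?_
      have := (hd x x' hx).segment_le m h (hB.pos _).le
      rw [h2, mul_zero] at this
      exact le_antisymm this (zero_le)
    simp only [hp, h2, ENNReal.toReal_zero]
  simp_rw [hlaw]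
  have hpt : ∀ h, ENNReal.ofReal (a h * p x h) * s.indicator 1 (M.record m h) ≤
      ENNReal.ofReal (Real.exp ε) *
        (ENNReal.ofReal (a h * p x' h) * s.indicator 1 (M.record m h)) +
      ENNReal.ofReal (Real.exp (-(l * ε)) * (a h * ratioMoment l (p x h) (p x' h))) := by
    intro h
    by_cases hm : M.record m h ∈ s
    · simp only [Set.indicator_of_mem hm, Pi.one_apply, mul_one]
      have hr := ratioMoment_nonneg l (hp0 x h) (hp0 x' h)
      rw [← ENNReal.ofReal_mul (Real.exp_pos _).le,
        ← ENNReal.ofReal_add (mul_nonneg (Real.exp_pos _).le (mul_nonneg (ha0 h) (hp0 x' h)))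
          (mul_nonneg (Real.exp_pos _).le (mul_nonneg (ha0 h) hr))]
      apply ENNReal.ofReal_le_ofReal
      have := mul_le_mul_of_nonneg_left
        (le_exp_mul_add_ratioMoment l ε (hp0 x h) (hp0 x' h) (hzero h)) (ha0 h)
      linarith
    · simp [Set.indicator_of_notMem hm]
  refine (Finset.sum_le_sum fun h _ => hpt h).trans ?_
  rw [Finset.sum_add_distrib, ← Finset.mul_sum]
  gcongr
  rw [← ENNReal.ofReal_sum_of_nonneg fun h _ => mul_nonneg (Real.exp_pos _).le
    (mul_nonneg (ha0 h) (ratioMoment_nonneg l (hp0 x h) (hp0 x' h)))]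
  apply ENNReal.ofReal_le_ofReal
  rw [← Finset.mul_sum]
  refine le_trans (mul_le_mul_of_nonneg_left
    (sum_ratioMoment_le hB (hd x x' hx) (hd x' x hx') A m) (Real.exp_pos _).le) ?_
  rw [← Real.exp_add]
  refine le_trans (le_of_eq ?_) hstart
  ring_nf

end SparseMechanism

end

noncomputable section

/-! ### Failure probabilities of a mechanism -/

namespace SparseMechanism

variable {U : Type u} {n : ℕ} {Pub : Type u} {M : SparseMechanism U n Pub}
  [Fintype U] [DecidableEq U]

-- A union bound over rounds: a good state turns bad in one round with probability at most `b`, and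
-- bad states retain their mass.
open Classical in
theorem sum_law_bad_le {A : AdaptiveAnalyst U} {x : Dataset U n}
    {good : ∀ j, Hist U n j → ℕ → Prop} {b₀ b : ℝ≥0∞}
    (h₀ : ∑' r, (if good 0 (emptyHist U n) r then 0 else M.fresh M.start r) ≤ b₀)
    (hstep : ∀ j h r q, good j h r → ∑ o, M.outcome x (M.pub j h) q r o *
      ∑' r', (if good (j + 1) (h, q, o) r' then 0 else M.refresh (M.pub j h) q r o r') ≤ b)
    (hlaw : ∀ j, ∑ h, ∑' r, M.law A x j h r ≤ 1) (j : ℕ) :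
    ∑ h, ∑' r, (if good j h r then 0 else M.law A x j h r) ≤ b₀ + j * b := by
  induction j with
  | zero => rw [sum_hist_zero]; simpa [law] using h₀
  | succ j ih =>
    set w : Hist U n j → BoolQuery U → ℝ≥0∞ := fun h q => A.next j (M.record j h) {q} with hw
    have hw1 : ∀ h, ∑ q, w h q = 1 := fun h => by
      simp only [hw]
      rw [sum_measure_singleton]
      simp
    have hlawsum : ∀ h q o, ∑' r', (if good (j + 1) (h, q, o) r' then 0 else
        M.law A x (j + 1) (h, q, o) r') = ∑' r, M.law A x j h r * (w h q *
          (M.outcome x (M.pub j h) q r o * ∑' r', (if good (j + 1) (h, q, o) r' then 0 else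
            M.refresh (M.pub j h) q r o r'))) := by
      intro h q o
      simp_rw [← ENNReal.tsum_mul_left]
      rw [ENNReal.tsum_comm]
      refine tsum_congr fun r' => ?_
      split_ifs
      · simp
      · simp only [law, step_apply, hw]
    have hround : ∀ h r, ∑ q, ∑ o, w h q * (M.outcome x (M.pub j h) q r o *
        ∑' r', (if good (j + 1) (h, q, o) r' then 0 else M.refresh (M.pub j h) q r o r')) ≤
        (if good j h r then 0 else 1) + b := by
      intro h r
      have hq : ∀ q, ∑ o, (M.outcome x (M.pub j h) q r o *
          ∑' r', (if good (j + 1) (h, q, o) r' then 0 else M.refresh (M.pub j h) q r o r')) ≤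
          (if good j h r then 0 else 1) + b := by
        intro q
        split_ifs with hg
        · simpa using hstep j h r q hg
        · refine le_trans ?_ le_self_add
          calc _ ≤ ∑ o, M.outcome x (M.pub j h) q r o * 1 := by
                refine Finset.sum_le_sum fun o _ => ?_
                gcongr
                rw [← (M.refresh (M.pub j h) q r o).tsum_coe]
                refine ENNReal.tsum_le_tsum fun r' => ?_
                split_ifs <;> simp
            _ = 1 := by
                simp only [mul_one]
                rw [← tsum_fintype (L := .unconditional _), PMF.tsum_coe]
      calc _ = ∑ q, w h q * ∑ o, (M.outcome x (M.pub j h) q r o *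
          ∑' r', (if good (j + 1) (h, q, o) r' then 0 else M.refresh (M.pub j h) q r o r')) :=
            Finset.sum_congr rfl fun q _ => (Finset.mul_sum _ _ _).symm
        _ ≤ ∑ q, w h q * ((if good j h r then 0 else 1) + b) :=
            Finset.sum_le_sum fun q _ => mul_le_mul_right (hq q) _
        _ = _ := by rw [← Finset.sum_mul, hw1, one_mul]
    rw [sum_hist_succ]
    calc _ = ∑ h, ∑' r, M.law A x j h r * ∑ q, ∑ o, w h q * (M.outcome x (M.pub j h) q r o *
        ∑' r', (if good (j + 1) (h, q, o) r' then 0 else M.refresh (M.pub j h) q r o r')) := by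
          refine Finset.sum_congr rfl fun h _ => ?_
          simp_rw [hlawsum, Finset.mul_sum]
          rw [Summable.tsum_finsetSum fun _ _ => ENNReal.summable]
          refine Finset.sum_congr rfl fun q _ => ?_
          rw [Summable.tsum_finsetSum fun _ _ => ENNReal.summable]
      _ ≤ ∑ h, ∑' r, M.law A x j h r * ((if good j h r then 0 else 1) + b) :=
          Finset.sum_le_sum fun h _ => ENNReal.tsum_le_tsum fun r =>
            mul_le_mul_right (hround h r) _
      _ = ∑ h, ∑' r, (if good j h r then 0 else M.law A x j h r) +
          (∑ h, ∑' r, M.law A x j h r) * b := by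
          rw [Finset.sum_mul, ← Finset.sum_add_distrib]
          refine Finset.sum_congr rfl fun h _ => ?_
          rw [← ENNReal.tsum_mul_right, ← ENNReal.tsum_add]
          refine tsum_congr fun r => ?_
          split_ifs <;> simp [mul_add]
      _ ≤ (b₀ + j * b) + 1 * b := by
          gcongr
          exact hlaw j
      _ = _ := by push_cast; ring

variable [Countable Pub]

theorem sum_law (A : AdaptiveAnalyst U) (x : Dataset U n) (j : ℕ) :
    ∑ h, ∑' r, M.law A x j h r = 1 := by
  have h := M.trans_apply A x j MeasurableSet.univ
  have h1 : IsProbabilityMeasure (trans M.algorithm A j x) :=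
    Measure.isProbabilityMeasure_map measurable_snd.aemeasurable
  simp only [measure_univ, Set.indicator_univ, Pi.one_apply, mul_one] at h
  exact h.symm

theorem le_trans_of_good {A : AdaptiveAnalyst U} {x : Dataset U n}
    {good : ∀ j, Hist U n j → ℕ → Prop} {b₀ b : ℝ≥0∞} {m : ℕ} {s : Set (Transcript U m)}
    (h₀ : open Classical in
      ∑' r, (if good 0 (emptyHist U n) r then 0 else M.fresh M.start r) ≤ b₀)
    (hstep : open Classical in ∀ j h r q, good j h r → ∑ o, M.outcome x (M.pub j h) q r o *
      ∑' r', (if good (j + 1) (h, q, o) r' then 0 else M.refresh (M.pub j h) q r o r') ≤ b)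
    (hs : ∀ h r, good m h r → M.record m h ∈ s) :
    1 - (b₀ + m * b) ≤ trans M.algorithm A m x s := by
  classical
  -- No measurability of `s` is assumed; the finite set of records of good histories is measurable
  -- and lies inside it.
  set s' : Set (Transcript U m) := M.record m '' {h | ∃ r, good m h r} with hs'
  have hsub : s' ⊆ s := by
    rintro _ ⟨h, ⟨r, hr⟩, rfl⟩
    exact hs h r hr
  refine le_trans ?_ (measure_mono hsub)
  rw [M.trans_apply A x m (Set.toFinite s').measurableSet, tsub_le_iff_right]
  have hbad := sum_law_bad_le (A := A) h₀ hstep (fun j => (sum_law A x j).le) m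
  refine le_trans ?_ (add_le_add_right hbad _)
  rw [← sum_law (M := M) A x m, ← Finset.sum_add_distrib]
  refine Finset.sum_le_sum fun h _ => ?_
  by_cases hg : ∃ r, good m h r
  · have hmem : M.record m h ∈ s' := ⟨h, hg, rfl⟩
    rw [Set.indicator_of_mem hmem, Pi.one_apply, mul_one]
    exact le_self_add
  · push Not at hg
    refine le_trans (ENNReal.tsum_le_tsum fun r => ?_) le_add_self
    simp [hg r]

end SparseMechanism

/-! ### Noise distributions -/

/-- The geometric distribution with ratio `exp (-e)`. -/
def geometric (e : ℝ) (he : 0 < e) : PMF ℕ :=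
  ⟨fun r => ENNReal.ofReal (Real.exp (-(e * r)) * (1 - Real.exp (-e))), by
    have h1 : Real.exp (-e) < 1 := by simpa using he
    have h2 := (hasSum_geometric_of_lt_one (Real.exp_pos (-e)).le h1).mul_right
      (1 - Real.exp (-e))
    rw [inv_mul_cancel₀ (by linarith)] at h2
    simp_rw [← Real.exp_nat_mul, mul_neg, mul_comm _ e] at h2
    apply ENNReal.hasSum_coe.mpr
    rw [← Real.toNNReal_one]
    exact h2.toNNReal fun r => mul_nonneg (Real.exp_pos _).le (by linarith)⟩

theorem geometric_apply {e : ℝ} (he : 0 < e) (r : ℕ) :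
    geometric e he r = ENNReal.ofReal (Real.exp (-(e * r)) * (1 - Real.exp (-e))) := rfl

theorem geometric_add {e : ℝ} (he : 0 < e) (r s : ℕ) :
    geometric e he (r + s) = ENNReal.ofReal (Real.exp (-(e * s))) * geometric e he r := by
  rw [geometric_apply, geometric_apply, ← ENNReal.ofReal_mul (Real.exp_pos _).le, ← mul_assoc,
    ← Real.exp_add]
  congr 3
  push_cast
  ring

open Classical in
theorem tsum_geometric_tail_le {e : ℝ} (he : 0 < e) (c : ℝ) {p : ℕ → Prop}
    (hp : ∀ r : ℕ, (r : ℝ) ≤ c → p r) :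
    ∑' r, (if p r then 0 else geometric e he r) ≤ ENNReal.ofReal (Real.exp (-(e * c))) := by
  set s := ⌈c⌉₊ with hs
  rw [← ENNReal.summable.sum_add_tsum_nat_add' (k := s) (f := fun r => if p r then 0 else
    geometric e he r)]
  have h1 : ∑ r ∈ Finset.range s, (if p r then 0 else geometric e he r) = 0 := by
    refine Finset.sum_eq_zero fun r hr => if_pos (hp r ?_)
    exact (Nat.lt_ceil.1 (Finset.mem_range.1 hr)).le
  rw [h1, zero_add]
  calc ∑' r, (if p (r + s) then 0 else geometric e he (r + s))
      ≤ ∑' r, ENNReal.ofReal (Real.exp (-(e * s))) * geometric e he r := by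
        refine ENNReal.tsum_le_tsum fun r => ?_
        rw [geometric_add]
        split_ifs <;> simp
    _ = ENNReal.ofReal (Real.exp (-(e * s))) := by
        rw [ENNReal.tsum_mul_left, PMF.tsum_coe, mul_one]
    _ ≤ _ := by
        apply ENNReal.ofReal_le_ofReal
        apply Real.exp_le_exp.2
        have := Nat.le_ceil c
        nlinarith

/-- The total weight of the noisy answers to a query with count `c`. -/
def noiseMass (n : ℕ) (e : ℝ) (c : ℕ) : ℝ :=
  ∑ z : Fin (n + 1), Real.exp (-(e * |((z : ℕ) : ℝ) - c|))

/-- The probability of the noisy answer `z` to a query with count `c`. -/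
def noise (n : ℕ) (e : ℝ) (c : ℕ) (z : Fin (n + 1)) : ℝ :=
  Real.exp (-(e * |((z : ℕ) : ℝ) - c|)) / noiseMass n e c

theorem noiseMass_pos (n : ℕ) (e : ℝ) (c : ℕ) : 0 < noiseMass n e c :=
  Finset.sum_pos (fun _ _ => Real.exp_pos _) ⟨0, Finset.mem_univ _⟩

theorem noise_nonneg (n : ℕ) (e : ℝ) (c : ℕ) (z : Fin (n + 1)) : 0 ≤ noise n e c z :=
  div_nonneg (Real.exp_pos _).le (noiseMass_pos n e c).le

theorem sum_noise (n : ℕ) (e : ℝ) (c : ℕ) : ∑ z, noise n e c z = 1 := by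
  unfold noise
  rw [← Finset.sum_div]
  exact div_self (noiseMass_pos n e c).ne'

theorem exp_noise_le {e : ℝ} (he : 0 < e) {c c' : ℕ} (h : |(c : ℝ) - c'| ≤ 1) (z : ℝ) :
    Real.exp (-(e * |z - c|)) ≤ Real.exp e * Real.exp (-(e * |z - c'|)) := by
  rw [← Real.exp_add]
  apply Real.exp_le_exp.2
  have := abs_sub_le z c c'
  nlinarith

/-- One factor `exp e` comes from the weight of `z`, another from the normalisation, which depends
on the count because the noise is confined to `0, …, n`. -/
theorem noise_le {n : ℕ} {e : ℝ} (he : 0 < e) {c c' : ℕ} (h : |(c : ℝ) - c'| ≤ 1)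
    (z : Fin (n + 1)) : noise n e c z ≤ Real.exp (2 * e) * noise n e c' z := by
  have h' : |(c' : ℝ) - c| ≤ 1 := by rwa [abs_sub_comm]
  have h1 : noiseMass n e c' ≤ Real.exp e * noiseMass n e c := by
    unfold noiseMass
    rw [Finset.mul_sum]
    exact Finset.sum_le_sum fun z _ => exp_noise_le he h' _
  have h2 := exp_noise_le he h ((z : ℕ) : ℝ)
  unfold noise
  rw [← mul_div_assoc, div_le_div_iff₀ (noiseMass_pos n e c) (noiseMass_pos n e c')]
  calc Real.exp (-(e * |((z : ℕ) : ℝ) - c|)) * noiseMass n e c'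
      ≤ (Real.exp e * Real.exp (-(e * |((z : ℕ) : ℝ) - c'|))) * (Real.exp e * noiseMass n e c) :=
        mul_le_mul h2 h1 (noiseMass_pos n e c').le (by positivity)
    _ = _ := by rw [two_mul, Real.exp_add]; ring

/-- An injection moving each `z` closer to `c` by `s` multiplies its mass by at least `exp (e s)`,
while the image has mass at most 1. This gives tails without evaluating `noiseMass`. -/
theorem sum_noise_shift_le {n : ℕ} {e : ℝ} {c : ℕ} {s : ℝ} (he : 0 < e)
    (p : Fin (n + 1) → Prop) [DecidablePred p] (f : Fin (n + 1) → Fin (n + 1))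
    (hinj : ∀ z w, p z → p w → f z = f w → z = w)
    (hf : ∀ z, p z → |((f z : ℕ) : ℝ) - c| + s ≤ |((z : ℕ) : ℝ) - c|) :
    ∑ z with p z, noise n e c z ≤ Real.exp (-(e * s)) := by
  calc ∑ z with p z, noise n e c z
      ≤ ∑ z with p z, Real.exp (-(e * s)) * noise n e c (f z) := by
        refine Finset.sum_le_sum fun z hz => ?_
        have := hf z (Finset.mem_filter.1 hz).2
        unfold noise
        rw [← mul_div_assoc, ← Real.exp_add]
        have := noiseMass_pos n e c
        gcongr
        nlinarith
    _ = Real.exp (-(e * s)) * ∑ w ∈ (Finset.univ.filter p).image f, noise n e c w := by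
        rw [← Finset.mul_sum, Finset.sum_image]
        intro z hz w hw
        exact hinj z w (Finset.mem_filter.1 hz).2 (Finset.mem_filter.1 hw).2
    _ ≤ Real.exp (-(e * s)) * 1 := by
        gcongr
        rw [← sum_noise n e c]
        exact Finset.sum_le_sum_of_subset_of_nonneg (Finset.subset_univ _)
          fun z _ _ => noise_nonneg n e c z
    _ = _ := mul_one _

theorem sum_noise_tail_le {n : ℕ} {e s : ℝ} (he : 0 < e) {c : ℕ} (hc : c ≤ n) :
    ∑ z ∈ Finset.univ.filter (fun z : Fin (n + 1) => s < |((z : ℕ) : ℝ) - c|), noise n e c z ≤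
      2 * Real.exp (-(e * s)) := by
  classical
  set k := ⌈s⌉₊ with hk
  have hsk : s ≤ k := Nat.le_ceil s
  have h1 : ∑ z ∈ Finset.univ.filter (fun z : Fin (n + 1) => c + k ≤ (z : ℕ)), noise n e c z ≤
      Real.exp (-(e * s)) := by
    refine sum_noise_shift_le he _ (fun z => ⟨z - k, by omega⟩) ?_ ?_
    · intro z w hz hw h
      simp only [Fin.mk.injEq] at h
      ext; omega
    · intro z hz
      have h2 : (((z : ℕ) - k : ℕ) : ℝ) = ((z : ℕ) : ℝ) - k := Nat.cast_sub (by omega)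
      have h3 : (c : ℝ) + k ≤ ((z : ℕ) : ℝ) := by exact_mod_cast hz
      simp only [h2]
      rw [abs_of_nonneg (by linarith), abs_of_nonneg (by linarith)]
      linarith
  have h2 : ∑ z ∈ Finset.univ.filter (fun z : Fin (n + 1) => (z : ℕ) + k ≤ c), noise n e c z ≤
      Real.exp (-(e * s)) := by
    refine sum_noise_shift_le he _ (fun z => if h : (z : ℕ) + k ≤ n then ⟨z + k, by omega⟩ else z)
      ?_ ?_
    · intro z w hz hw h
      rw [dif_pos (hz.trans hc), dif_pos (hw.trans hc)] at h
      simp only [Fin.mk.injEq] at h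
      ext; omega
    · intro z hz
      rw [dif_pos (hz.trans hc)]
      have h3 : ((z : ℕ) : ℝ) + k ≤ c := by exact_mod_cast hz
      push_cast
      rw [abs_of_nonpos (by linarith), abs_of_nonpos (by linarith)]
      linarith
  have hsub : (Finset.univ.filter fun z : Fin (n + 1) => s < |((z : ℕ) : ℝ) - c|) ⊆
      (Finset.univ.filter fun z : Fin (n + 1) => c + k ≤ (z : ℕ)) ∪
      (Finset.univ.filter fun z : Fin (n + 1) => (z : ℕ) + k ≤ c) := by
    intro z hz
    simp only [Finset.mem_filter, Finset.mem_univ, true_and, Finset.mem_union] at hz ⊢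
    rcases le_total c (z : ℕ) with h | h
    · left
      have h' : (c : ℝ) ≤ ((z : ℕ) : ℝ) := by exact_mod_cast h
      rw [abs_of_nonneg (by linarith), ← Nat.cast_sub h] at hz
      have := Nat.ceil_le.2 hz.le
      omega
    · right
      have h' : ((z : ℕ) : ℝ) ≤ c := by exact_mod_cast h
      rw [abs_of_nonpos (by linarith), neg_sub, ← Nat.cast_sub h] at hz
      have := Nat.ceil_le.2 hz.le
      omega
  calc _ ≤ _ := Finset.sum_le_sum_of_subset_of_nonneg hsub fun z _ _ => noise_nonneg n e c z
    _ ≤ (∑ z ∈ Finset.univ.filter (fun z : Fin (n + 1) => c + k ≤ (z : ℕ)), noise n e c z) +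
        ∑ z ∈ Finset.univ.filter (fun z : Fin (n + 1) => (z : ℕ) + k ≤ c), noise n e c z := by
        rw [← Finset.sum_union_inter]
        exact le_add_of_nonneg_right (Finset.sum_nonneg fun z _ => noise_nonneg n e c z)
    _ ≤ _ := by linarith

end

noncomputable section

/-! ### Counts -/

variable {U : Type u} {n : ℕ}

/-- The number of data points on which the query holds. -/
def count (q : BoolQuery U) (x : Dataset U n) : ℕ :=
  (Finset.univ.filter fun i => q (x i) = true).card

theorem count_le (q : BoolQuery U) (x : Dataset U n) : count q x ≤ n :=
  (Finset.card_filter_le _ _).trans (by simp)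

theorem cast_count (q : BoolQuery U) (x : Dataset U n) :
    (count q x : ℝ) = ∑ i, truth q (x i) := by
  simp [count, truth]

theorem queryValue_eq (q : BoolQuery U) (x : Dataset U n) : queryValue q x = count q x / n := by
  rw [queryValue, cast_count]

theorem abs_truth_sub_le (q : BoolQuery U) (u v : U) : |truth q u - truth q v| ≤ 1 := by
  unfold truth; split_ifs <;> simp

theorem Neighboring.abs_count_sub_le {x x' : Dataset U n} (h : Neighboring x x')
    (q : BoolQuery U) : |(count q x : ℝ) - count q x'| ≤ 1 := by
  obtain ⟨i, -, hi⟩ := h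
  rw [cast_count, cast_count, ← Finset.sum_sub_distrib, Finset.sum_eq_single i]
  · exact abs_truth_sub_le q _ _
  · intro j _ hj
    rw [hi j hj, sub_self]
  · simp

/-! ### Medians -/

/-- A median of the values of `f` on `V`. -/
def median {α : Type*} (V : Finset α) (f : α → ℕ) : ℕ :=
  sInf {p | V.card ≤ 2 * (V.filter fun y => f y ≤ p).card}

theorem mem_median_set {α : Type*} {V : Finset α} {f : α → ℕ} {b : ℕ} (hf : ∀ y, f y ≤ b) :
    V.card ≤ 2 * (V.filter fun y => f y ≤ b).card := by
  rw [Finset.filter_true_of_mem fun y _ => hf y]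
  omega

theorem median_le {α : Type*} {V : Finset α} {f : α → ℕ} {b : ℕ} (hf : ∀ y, f y ≤ b) :
    median V f ≤ b := Nat.sInf_le (mem_median_set hf)

/-- Values within `c` of `z` lie strictly on one side of the median, and neither strict side holds
more than half of `V`. -/
theorem two_mul_card_near_le {α : Type*} {V : Finset α} {f : α → ℕ} {b : ℕ} (hf : ∀ y, f y ≤ b)
    {z c : ℝ} (hz : c < |z - median V f|) :
    2 * (V.filter fun y => |(f y : ℝ) - z| ≤ c).card ≤ V.card := by
  set p := median V f with hp
  have hmem : V.card ≤ 2 * (V.filter fun y => f y ≤ p).card :=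
    Nat.sInf_mem (s := {p | V.card ≤ 2 * (V.filter fun y => f y ≤ p).card})
      ⟨b, mem_median_set hf⟩
  rcases le_total (p : ℝ) z with h | h
  · rw [abs_of_nonneg (by linarith)] at hz
    have hsub : (V.filter fun y => |(f y : ℝ) - z| ≤ c) ⊆ V.filter fun y => ¬ f y ≤ p := by
      intro y hy
      rw [Finset.mem_filter] at hy ⊢
      refine ⟨hy.1, fun hle => ?_⟩
      have h1 : (f y : ℝ) ≤ p := by exact_mod_cast hle
      have := (abs_le.1 hy.2).1
      linarith
    have h1 := Finset.card_le_card hsub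
    have h2 := Finset.card_filter_add_card_filter_not (s := V) (fun y => f y ≤ p)
    omega
  · rw [abs_of_nonpos (by linarith)] at hz
    -- The minimality of `p` is used at `p - 1`; for `p = 0` there is no such point, but nothing
    -- lies below the median either.
    rcases Nat.eq_zero_or_pos p with h0 | h0
    · have hsub : (V.filter fun y => |(f y : ℝ) - z| ≤ c) = ∅ := by
        refine Finset.filter_eq_empty_iff.2 fun y _ hle => ?_
        have := (abs_le.1 hle).2
        have h1 : (0 : ℝ) ≤ f y := by positivity
        rw [h0] at hz
        push_cast at hz
        linarith
      simp [hsub]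
    · have hsub : (V.filter fun y => |(f y : ℝ) - z| ≤ c) ⊆ V.filter fun y => f y ≤ p - 1 := by
        intro y hy
        rw [Finset.mem_filter] at hy ⊢
        refine ⟨hy.1, ?_⟩
        have := (abs_le.1 hy.2).2
        have h1 : (f y : ℝ) < p := by linarith
        have h2 : f y < p := by exact_mod_cast h1
        omega
      have h1 := Finset.card_le_card hsub
      have h2 : p - 1 ∉ {p | V.card ≤ 2 * (V.filter fun y => f y ≤ p).card} :=
        Nat.notMem_of_lt_sInf (by rw [← median, ← hp]; omega)
      simp only [Set.mem_ofPred_eq, not_le] at h2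
      omega

/-! ### The mechanism -/

/-- The parameters of the mechanism: the number of halvings before the first stage, the privacy of
a round in each stage, and the number of scales of noise that are tolerated. -/
structure Schedule where
  depth : ℕ
  scale : ℕ → ℝ
  scale_pos : ∀ k, 0 < scale k
  scale_anti : Antitone scale
  width : ℝ
  width_nonneg : 0 ≤ width

namespace Schedule

variable (P : Schedule)

/-- The noise tolerated in stage `k`. -/
def tol (k : ℕ) : ℝ := P.width / P.scale k

theorem tol_nonneg (k : ℕ) : 0 ≤ P.tol k := div_nonneg P.width_nonneg (P.scale_pos k).le

theorem tol_mono : Monotone P.tol := fun _ _ h =>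
  div_le_div_of_nonneg_left P.width_nonneg (P.scale_pos _) (P.scale_anti h)

theorem scale_mul_tol (k : ℕ) : P.scale k * P.tol k = P.width :=
  mul_div_cancel₀ _ (P.scale_pos k).ne'

end Schedule

/-- The value, in stage `k`, of the query `q` on the hypothesis `y`. -/
def guess (P : Schedule) (n k : ℕ) (q : BoolQuery U) (y : Multiset U) : ℕ :=
  min n (2 ^ (P.depth - k) * y.countP fun u => q u = true)

theorem guess_le (P : Schedule) (n k : ℕ) (q : BoolQuery U) (y : Multiset U) :
    guess P n k q y ≤ n := min_le_left _ _

/-- The hypotheses of size at most `s`. -/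
def smallMultisets (U : Type u) [Fintype U] [DecidableEq U] (s : ℕ) : Finset (Multiset U) :=
  (Finset.univ : Finset (List.Vector (Option U) s)).image
    -- Padding with `none` covers all sizes up to `s` at once and makes the count at most `(N + 1) ^
    -- s`.
    fun v => ((v.1 : Multiset (Option U)).filterMap id)

section Small

variable [Fintype U] [DecidableEq U]

theorem mem_smallMultisets {s : ℕ} {y : Multiset U} (hy : y.card ≤ s) :
    y ∈ smallMultisets U s := by
  induction y using Quotient.inductionOn with
  | h l =>
    have hl : l.length ≤ s := hy
    refine Finset.mem_image.2 ⟨⟨l.map some ++ List.replicate (s - l.length) none, ?_⟩,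
      Finset.mem_univ _, ?_⟩
    · simp; omega
    · simp [List.filterMap_append]

theorem card_smallMultisets_le (s : ℕ) :
    (smallMultisets U s).card ≤ (Fintype.card U + 1) ^ s := by
  refine Finset.card_image_le.trans ?_
  rw [Finset.card_univ, card_vector, Fintype.card_option]

end Small

/-- The probability of answering afresh when the prediction is off by `v`. -/
def fireProb (P : Schedule) (k : ℕ) (v : ℝ) (r : ℕ) : ℝ :=
  min 1 (Real.exp (P.scale k * (v - 4 * P.tol k - r)))

theorem fireProb_nonneg (P : Schedule) (k : ℕ) (v : ℝ) (r : ℕ) : 0 ≤ fireProb P k v r :=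
  le_min zero_le_one (Real.exp_pos _).le

theorem fireProb_le_one (P : Schedule) (k : ℕ) (v : ℝ) (r : ℕ) : fireProb P k v r ≤ 1 :=
  min_le_left _ _

/-- The public state: the stage and the hypotheses still considered. -/
abbrev PubState (U : Type u) : Type u := ℕ × Finset (Multiset U)

/-- The prediction for a query. -/
def predict (P : Schedule) (n : ℕ) (σ : PubState U) (q : BoolQuery U) : ℕ :=
  median σ.2 (guess P n σ.1 q)

theorem predict_le (P : Schedule) (n : ℕ) (σ : PubState U) (q : BoolQuery U) :
    predict P n σ q ≤ n := median_le (guess_le P n σ.1 q)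

/-- The hypotheses compatible with a noisy answer. -/
def survivors (P : Schedule) (n : ℕ) (σ : PubState U) (q : BoolQuery U) (z : ℕ) :
    Finset (Multiset U) :=
  σ.2.filter fun y => |(guess P n σ.1 q y : ℝ) - z| ≤ 2 * P.tol σ.1

/-- The law of the outcome of a round. -/
def outcomeLaw (P : Schedule) (x : Dataset U n) (σ : PubState U) (q : BoolQuery U) (r : ℕ) :
    PMF (Option (Fin (n + 1))) :=
  PMF.ofFintype (fun o => o.elim
    (ENNReal.ofReal (1 - fireProb P σ.1 |(count q x : ℝ) - predict P n σ q| r))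
    fun z => ENNReal.ofReal (fireProb P σ.1 |(count q x : ℝ) - predict P n σ q| r *
      noise n (P.scale σ.1) (count q x) z)) (by
    have h1 := fireProb_le_one P σ.1 |(count q x : ℝ) - predict P n σ q| r
    have h0 := fireProb_nonneg P σ.1 |(count q x : ℝ) - predict P n σ q| r
    rw [Fintype.sum_option]
    simp only [Option.elim_none, Option.elim_some]
    rw [← ENNReal.ofReal_sum_of_nonneg fun z _ => mul_nonneg h0 (noise_nonneg _ _ _ z),
      ← Finset.mul_sum, sum_noise, mul_one,
      ← ENNReal.ofReal_add (by linarith) h0, sub_add_cancel, ENNReal.ofReal_one])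

/-- The hypothesis `y` of stage `k` is accurate on all queries of the transcript. -/
def Accurate (P : Schedule) (x : Dataset U n) (k : ℕ) (y : Multiset U) {j : ℕ}
    (t : Transcript U j) : Prop :=
  ∀ i, |(guess P n k (t i).1 y : ℝ) - count (t i).1 x| ≤ P.tol k

theorem accurate_snoc {P : Schedule} {x : Dataset U n} {k : ℕ} {y : Multiset U} {j : ℕ}
    {t : Transcript U j} {p : BoolQuery U × ℝ} :
    Accurate P x k y (Fin.snoc t p : Transcript U (j + 1)) ↔
      Accurate P x k y t ∧ |(guess P n k p.1 y : ℝ) - count p.1 x| ≤ P.tol k := by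
  constructor
  · intro h
    refine ⟨fun i => ?_, ?_⟩
    · have := h i.castSucc
      rwa [Fin.snoc_castSucc] at this
    · have := h (Fin.last j)
      rwa [Fin.snoc_last] at this
  · rintro ⟨h1, h2⟩ i
    refine Fin.lastCases ?_ (fun i => ?_) i
    · rwa [Fin.snoc_last]
    · rw [Fin.snoc_castSucc]; exact h1 i

variable [Fintype U] [DecidableEq U]

/-- The hypotheses of stage `k`. -/
def candidates (U : Type u) [Fintype U] [DecidableEq U] (k : ℕ) : Finset (Multiset U) :=
  smallMultisets U (2 ^ (k + 1))

open Classical in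
/-- The halving mechanism: it predicts a median of the hypotheses still considered, and when the
prediction is noticeably wrong it publishes a noisy answer and drops the hypotheses that are not
compatible with it, moving to the next stage when they are exhausted. -/
def halving (P : Schedule) (U : Type u) [Fintype U] [DecidableEq U] (n : ℕ) :
    SparseMechanism U n (PubState U) where
  start := (0, candidates U 0)
  fresh σ := geometric (P.scale σ.1) (P.scale_pos σ.1)
  outcome := outcomeLaw P
  next σ q z :=
    -- The halving is tested rather than assumed, so the privacy budget holds even when the noise is
    -- excessive.
    if (survivors P n σ q z).Nonempty ∧ 2 * (survivors P n σ q z).card ≤ σ.2.card then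
      (σ.1, survivors P n σ q z)
    else (σ.1 + 1, candidates U (σ.1 + 1))
  reply σ q o := (o.elim (predict P n σ q) (fun z => (z : ℕ)) : ℕ) / n

theorem halving_outcome_none (P : Schedule) (x : Dataset U n) (σ : PubState U) (q : BoolQuery U)
    (r : ℕ) : (halving P U n).outcome x σ q r none =
      ENNReal.ofReal (1 - fireProb P σ.1 |(count q x : ℝ) - predict P n σ q| r) := rfl

theorem halving_outcome_some (P : Schedule) (x : Dataset U n) (σ : PubState U) (q : BoolQuery U)
    (r : ℕ) (z : Fin (n + 1)) : (halving P U n).outcome x σ q r (some z) =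
      ENNReal.ofReal (fireProb P σ.1 |(count q x : ℝ) - predict P n σ q| r *
        noise n (P.scale σ.1) (count q x) z) := rfl

/-- A neighbour changes the prediction error `v` by at most 1, so `v - r` cannot increase when `r`
becomes `r + 1`: staying is no less likely. A publication costs `2 * scale` for firing, as `v - r`
drops by at most 2, and `2 * scale` for the noise. -/
theorem halving_dominated (P : Schedule) {x x' : Dataset U n} (hx : Neighboring x x') :
    (halving P U n).Dominated (fun σ => P.scale σ.1) x x' where
  fresh σ r := by
    change geometric _ (P.scale_pos σ.1) r ≤ _ * geometric _ (P.scale_pos σ.1) (r + 1)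
    rw [geometric_add, ← mul_assoc, ← ENNReal.ofReal_mul (Real.exp_pos _).le, ← Real.exp_add]
    simp
  stay σ q r := by
    rw [halving_outcome_none, halving_outcome_none]
    apply ENNReal.ofReal_le_ofReal
    have h1 := hx.abs_count_sub_le q
    have h2 := abs_sub_le (count q x' : ℝ) (count q x) (predict P n σ q)
    rw [abs_sub_comm (count q x' : ℝ) (count q x)] at h2
    unfold fireProb
    have h3 : P.scale σ.1 * (|(count q x' : ℝ) - predict P n σ q| - 4 * P.tol σ.1 -
        ((r + 1 : ℕ) : ℝ)) ≤
        P.scale σ.1 * (|(count q x : ℝ) - predict P n σ q| - 4 * P.tol σ.1 - r) := by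
      apply mul_le_mul_of_nonneg_left _ (P.scale_pos _).le
      push_cast
      linarith
    have h4 := min_le_min_left 1 (Real.exp_le_exp.2 h3)
    linarith
  change σ q r z := by
    rw [halving_outcome_some, halving_outcome_some, ← ENNReal.ofReal_mul (Real.exp_pos _).le]
    apply ENNReal.ofReal_le_ofReal
    have h1 := hx.abs_count_sub_le q
    have h2 := abs_sub_le (count q x : ℝ) (count q x') (predict P n σ q)
    have hs := P.scale_pos σ.1
    have h3 : fireProb P σ.1 |(count q x : ℝ) - predict P n σ q| r ≤ Real.exp (2 * P.scale σ.1) *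
        fireProb P σ.1 |(count q x' : ℝ) - predict P n σ q| (r + 1) := by
      unfold fireProb
      rw [mul_min_of_nonneg _ _ (Real.exp_pos _).le, ← Real.exp_add]
      refine min_le_min ?_ ?_
      · rw [mul_one]
        exact Real.one_le_exp (by linarith)
      · apply Real.exp_le_exp.2
        push_cast
        nlinarith
    have h4 := noise_le (n := n) hs h1 z
    calc _ ≤ (Real.exp (2 * P.scale σ.1) *
        fireProb P σ.1 |(count q x' : ℝ) - predict P n σ q| (r + 1)) *
        (Real.exp (2 * P.scale σ.1) * noise n (P.scale σ.1) (count q x') z) :=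
          mul_le_mul h3 h4 (noise_nonneg _ _ _ _)
            (mul_nonneg (Real.exp_pos _).le (fireProb_nonneg _ _ _ _))
      _ = _ := by
          rw [show 4 * P.scale σ.1 = 2 * P.scale σ.1 + 2 * P.scale σ.1 by ring, Real.exp_add]
          ring

/-- The privacy budget of the halving mechanism. -/
def budget (P : Schedule) (l : ℕ) (a : ℝ) (σ : PubState U) : ℝ :=
  a / (σ.1 + 2) + (l + 1) ^ 2 * (5 * P.scale σ.1) ^ 2 / 2 * (Nat.log 2 σ.2.card + 1)

theorem budget_candidates_le {P : Schedule} {l : ℕ} {a : ℝ} {k : ℕ}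
    (ha : (l + 1) ^ 2 * (5 * P.scale k) ^ 2 / 2 * (Nat.log 2 (candidates U k).card + 1) ≤
      a / ((k + 1) * (k + 2))) : budget P l a (k, candidates U k) ≤ a / (k + 1) := by
  unfold budget
  have : a / ((k : ℝ) + 1) = a / (k + 2) + a / ((k + 1) * (k + 2)) := by
    field_simp
    ring
  rw [this]
  gcongr

/-- Within a stage, halving lowers `Nat.log 2` by at least one and so releases the cost of one
publication. The extra `+ 1` pays for the publication that ends the stage. A new stage is financed
by the telescoping `a / (k + 1) - a / (k + 2)`. -/
theorem halving_budget {P : Schedule} {l : ℕ} {a : ℝ} (ha0 : 0 ≤ a)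
    (ha : ∀ k, (l + 1) ^ 2 * (5 * P.scale k) ^ 2 / 2 * (Nat.log 2 (candidates U k).card + 1) ≤
      a / ((k + 1) * (k + 2))) :
    (halving P U n).Budget (fun σ => P.scale σ.1) l (budget P l a) where
  pos σ := P.scale_pos σ.1
  le σ := by
    unfold budget
    have h1 : 0 ≤ a / ((σ.1 : ℝ) + 2) := by positivity
    have h2 : (0 : ℝ) ≤ Nat.log 2 σ.2.card := by positivity
    have h3 : 0 ≤ ((l : ℝ) + 1) ^ 2 * (5 * P.scale σ.1) ^ 2 / 2 := by positivity
    nlinarith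
  next σ q z := by
    have h3 : 0 ≤ ((l : ℝ) + 1) ^ 2 * (5 * P.scale σ.1) ^ 2 / 2 := by positivity
    simp only [halving]
    split_ifs with h
    · unfold budget
      have hc : Nat.log 2 (survivors P n σ q z).card + 1 ≤ Nat.log 2 σ.2.card := by
        rw [← Nat.log_mul_base one_lt_two (Finset.card_pos.2 h.1).ne', mul_comm]
        exact Nat.log_mono_right h.2
      have hc' : ((Nat.log 2 (survivors P n σ q z).card : ℕ) : ℝ) + 1 ≤ Nat.log 2 σ.2.card := by
        exact_mod_cast hc
      dsimp only
      nlinarith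
    · have h1 := budget_candidates_le (U := U) (P := P) (ha (σ.1 + 1))
      have h2 : (0 : ℝ) ≤ Nat.log 2 σ.2.card := by positivity
      have h4 : a / (((σ.1 + 1 : ℕ) : ℝ) + 1) = a / (σ.1 + 2) := by
        push_cast; ring_nf
      rw [h4] at h1
      unfold budget at h1 ⊢
      nlinarith

/-! ### Accuracy -/

/-- The answers are accurate at stage `k`, and earlier stages have no accurate hypothesis. -/
structure Sound (P : Schedule) (x : Dataset U n) (k : ℕ) {j : ℕ} (t : Transcript U j) : Prop where
  near : ∀ i, |queryValue (t i).1 x - (t i).2| ≤ min (5 * P.tol k / n) 1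
  earlier : ∀ l < k, ∀ y ∈ candidates U l, ¬ Accurate P x l y t

/-- The invariant of the halving mechanism when no noise is excessive. -/
structure Invariant (P : Schedule) (x : Dataset U n) (j : ℕ) (h : Hist U n j) (r : ℕ) : Prop where
  small : (r : ℝ) ≤ P.tol ((halving P U n).pub j h).1
  sound : Sound P x ((halving P U n).pub j h).1 ((halving P U n).record j h)
  mem : ∀ y ∈ candidates U ((halving P U n).pub j h).1,
    Accurate P x ((halving P U n).pub j h).1 y ((halving P U n).record j h) →
      y ∈ ((halving P U n).pub j h).2

theorem Sound.snoc {P : Schedule} {x : Dataset U n} {k : ℕ} {j : ℕ}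
    {t : Transcript U j} (h : Sound P x k t) {q : BoolQuery U} {c : ℕ} (hc : c ≤ n)
    (hq : |(count q x : ℝ) - c| ≤ 5 * P.tol k) :
    Sound P x k (Fin.snoc t (q, (c : ℝ) / n) : Transcript U (j + 1)) where
  near i := by
    refine Fin.lastCases ?_ (fun i => ?_) i
    · rw [Fin.snoc_last]
      dsimp only
      rw [queryValue_eq, ← sub_div, abs_div, Nat.abs_cast]
      refine le_min (by gcongr) (div_le_one_of_le₀ ?_ (Nat.cast_nonneg n))
      have h1 : (count q x : ℝ) ≤ n := by exact_mod_cast count_le q x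
      have h2 : (c : ℝ) ≤ n := by exact_mod_cast hc
      have h3 : (0 : ℝ) ≤ c := by positivity
      have h4 : (0 : ℝ) ≤ count q x := by positivity
      rw [abs_le]; constructor <;> linarith
    · rw [Fin.snoc_castSucc]; exact h.near i
  earlier k' hk y hy hacc := h.earlier k' hk y hy (accurate_snoc.1 hacc).1

theorem Sound.mono {P : Schedule} {x : Dataset U n} {k k' : ℕ} {j : ℕ}
    {t : Transcript U j} (h : Sound P x k t) (hk : k ≤ k')
    (h' : ∀ i < k', k ≤ i → ∀ y ∈ candidates U i, ¬ Accurate P x i y t) : Sound P x k' t where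
  near i := (h.near i).trans (min_le_min_right _ (by gcongr; exact P.tol_mono hk))
  earlier i hi y hy := by
    rcases lt_or_ge i k with h1 | h1
    · exact h.earlier i h1 y hy
    · exact h' i hi h1 y hy

theorem Invariant.stay {P : Schedule} {x : Dataset U n} {j : ℕ} {h : Hist U n j} {r : ℕ}
    (hI : Invariant P x j h r) {q : BoolQuery U}
    (hq : |(count q x : ℝ) - predict P n ((halving P U n).pub j h) q| ≤
      5 * P.tol ((halving P U n).pub j h).1) : Invariant P x (j + 1) (h, q, none) r where
  small := hI.small
  sound := hI.sound.snoc (predict_le P n _ q) hq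
  mem y hy hacc := hI.mem y hy (accurate_snoc.1 hacc).1

/-- With `T` the tolerance, noise at most `T` and prediction error above `3 T` put the published
count more than `2 T` from the median, so at least half the hypotheses die. An accurate hypothesis
is within `T` of the truth, hence within `2 T` of the published count, and survives. -/
theorem Invariant.change {P : Schedule} {x : Dataset U n} {j : ℕ} {h : Hist U n j} {r : ℕ}
    (hI : Invariant P x j h r) {q : BoolQuery U} {z : Fin (n + 1)}
    (hq : 3 * P.tol ((halving P U n).pub j h).1 <
      |(count q x : ℝ) - predict P n ((halving P U n).pub j h) q|)
    (hz : |((z : ℕ) : ℝ) - count q x| ≤ P.tol ((halving P U n).pub j h).1) {r' : ℕ}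
    (hr' : (r' : ℝ) ≤ P.tol ((halving P U n).next ((halving P U n).pub j h) q z).1) :
    Invariant P x (j + 1) (h, q, some z) r' := by
  set σ := (halving P U n).pub j h with hσ
  have htol := P.tol_nonneg σ.1
  have hpub : (halving P U n).pub (j + 1) (h, q, some z) = (halving P U n).next σ q z := rfl
  have hrec : (halving P U n).record (j + 1) (h, q, some z) =
      Fin.snoc ((halving P U n).record j h) (q, ((z : ℕ) : ℝ) / n) := rfl
  have hs := hI.sound.snoc (q := q) (c := (z : ℕ)) (by omega)
    (by rw [abs_sub_comm]; linarith)
  rw [← hσ] at hs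
  have hsurv : ∀ y ∈ candidates U σ.1, Accurate P x σ.1 y (Fin.snoc ((halving P U n).record j h)
      (q, ((z : ℕ) : ℝ) / n) : Transcript U (j + 1)) → y ∈ survivors P n σ q z := by
    intro y hy hacc
    rw [accurate_snoc] at hacc
    refine Finset.mem_filter.2 ⟨hI.mem y hy hacc.1, ?_⟩
    have h1 := abs_sub_le (guess P n σ.1 q y : ℝ) (count q x) ((z : ℕ) : ℝ)
    have h2 := hacc.2
    rw [abs_sub_comm (count q x : ℝ)] at h1
    dsimp only at h2
    linarith
  have hhalf : 2 * (survivors P n σ q z).card ≤ σ.2.card := by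
    refine two_mul_card_near_le (guess_le P n σ.1 q) ?_
    have h1 := abs_sub_le (count q x : ℝ) ((z : ℕ) : ℝ) (predict P n σ q)
    rw [abs_sub_comm (count q x : ℝ) ((z : ℕ) : ℝ)] at h1
    change 2 * P.tol σ.1 < |((z : ℕ) : ℝ) - predict P n σ q|
    linarith
  by_cases hne : (survivors P n σ q z).Nonempty
  · have hnext : (halving P U n).next σ q z = (σ.1, survivors P n σ q z) := if_pos ⟨hne, hhalf⟩
    refine ⟨by rw [hpub]; exact hr', ?_, ?_⟩
    · rw [hpub, hrec, hnext]; exact hs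
    · rw [hpub, hrec, hnext]; exact hsurv
  · have hnext : (halving P U n).next σ q z = (σ.1 + 1, candidates U (σ.1 + 1)) :=
      if_neg fun h => hne h.1
    refine ⟨by rw [hpub]; exact hr', ?_, ?_⟩
    · rw [hpub, hrec, hnext]
      refine hs.mono (Nat.le_succ _) fun i hi1 hi2 y hy hacc => ?_
      obtain rfl : i = σ.1 := by dsimp only at hi1; omega
      exact hne ⟨y, hsurv y hy hacc⟩
    · rw [hpub, hrec, hnext]; exact fun y hy _ => hy

open Classical in
theorem Invariant.step_le {P : Schedule} {x : Dataset U n} {j : ℕ} {h : Hist U n j} {r : ℕ}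
    (hI : Invariant P x j h r) (q : BoolQuery U) :
    ∑ o, (halving P U n).outcome x ((halving P U n).pub j h) q r o *
      ∑' r', (if Invariant P x (j + 1) (h, q, o) r' then 0 else
        (halving P U n).refresh ((halving P U n).pub j h) q r o r') ≤
      ENNReal.ofReal (3 * Real.exp (-P.width)) := by
  set σ := (halving P U n).pub j h with hσ
  set v := |(count q x : ℝ) - predict P n σ q| with hv
  have htol := P.tol_nonneg σ.1
  have hmul := P.scale_mul_tol σ.1
  have hpos := P.scale_pos σ.1
  have hf0 := fireProb_nonneg P σ.1 v r
  have hf1 := fireProb_le_one P σ.1 v r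
  have hexp := Real.exp_pos (-P.width)
  rw [Fintype.sum_option]
  have hnone : (halving P U n).outcome x σ q r none *
      ∑' r', (if Invariant P x (j + 1) (h, q, none) r' then 0 else
        (halving P U n).refresh σ q r none r') = 0 := by
    -- With counter at most one tolerance, an error above `5 * tol` fires with certainty, so a
    -- prediction that stands is harmless.
    rcases le_or_gt v (5 * P.tol σ.1) with h5 | h5
    · rw [mul_eq_zero]
      right
      refine ENNReal.tsum_eq_zero.2 fun r' => ?_
      by_cases hr : r' = r
      · subst hr
        exact if_pos (hI.stay h5)
      · simp [SparseMechanism.refresh, hr]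
    · rw [mul_eq_zero]
      left
      rw [halving_outcome_none]
      have h1 : fireProb P σ.1 v r = 1 := by
        refine min_eq_left (Real.one_le_exp (mul_nonneg hpos.le ?_))
        have := hI.small
        rw [← hσ] at this
        linarith
      rw [← hv, h1]
      simp
  rw [hnone, zero_add]
  have hbad : ∀ z, ∑' r', (if Invariant P x (j + 1) (h, q, some z) r' then 0 else
      (halving P U n).refresh σ q r (some z) r') ≤ 1 := by
    intro z
    rw [← ((halving P U n).refresh σ q r (some z)).tsum_coe]
    refine ENNReal.tsum_le_tsum fun r' => ?_
    split_ifs <;> simp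
  -- Firing at an error of at most `3 * tol` has probability at most `exp (-width)`. Above that, the
  -- failures are a large noise, of probability `2 * exp (-width)`, and a large new counter, of
  -- probability `exp (-width)`.
  rcases le_or_gt v (3 * P.tol σ.1) with h3 | h3
  · calc _ ≤ ∑ z, ENNReal.ofReal (fireProb P σ.1 v r * noise n (P.scale σ.1) (count q x) z) :=
          Finset.sum_le_sum fun z _ => mul_le_of_le_one_right' (hbad z)
      _ = ENNReal.ofReal (fireProb P σ.1 v r) := by
          rw [← ENNReal.ofReal_sum_of_nonneg fun z _ => mul_nonneg hf0 (noise_nonneg _ _ _ z),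
            ← Finset.mul_sum, sum_noise, mul_one]
      _ ≤ _ := by
          apply ENNReal.ofReal_le_ofReal
          have h1 : fireProb P σ.1 v r ≤ Real.exp (-P.width) := by
            refine (min_le_right _ _).trans (Real.exp_le_exp.2 ?_)
            rw [← hmul]
            have : (0 : ℝ) ≤ r := by positivity
            nlinarith
          linarith
  · have hgood : ∀ z : Fin (n + 1), |((z : ℕ) : ℝ) - count q x| ≤ P.tol σ.1 →
        ∑' r', (if Invariant P x (j + 1) (h, q, some z) r' then 0 else
          (halving P U n).refresh σ q r (some z) r') ≤ ENNReal.ofReal (Real.exp (-P.width)) := by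
      intro z hz
      rw [← P.scale_mul_tol ((halving P U n).next σ q z).1]
      exact tsum_geometric_tail_le (P.scale_pos _) _ fun r' hr' => hI.change h3 hz hr'
    calc _ ≤ ∑ z : Fin (n + 1), ENNReal.ofReal (noise n (P.scale σ.1) (count q x) z *
          Real.exp (-P.width) + if P.tol σ.1 < |((z : ℕ) : ℝ) - count q x| then
            noise n (P.scale σ.1) (count q x) z else 0) := by
          refine Finset.sum_le_sum fun z _ => ?_
          have hn := noise_nonneg n (P.scale σ.1) (count q x) z
          have h1 : (halving P U n).outcome x σ q r (some z) ≤
              ENNReal.ofReal (noise n (P.scale σ.1) (count q x) z) := by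
            rw [halving_outcome_some]
            exact ENNReal.ofReal_le_ofReal (mul_le_of_le_one_left hn hf1)
          split_ifs with hz
          · refine (mul_le_mul' h1 (hbad z)).trans ?_
            rw [mul_one]
            apply ENNReal.ofReal_le_ofReal
            have := mul_nonneg hn hexp.le
            linarith
          · refine (mul_le_mul' h1 (hgood z (not_lt.1 hz))).trans ?_
            rw [← ENNReal.ofReal_mul hn, add_zero]
      _ = ENNReal.ofReal (Real.exp (-P.width) + ∑ z ∈ Finset.univ.filter
            (fun z : Fin (n + 1) => P.tol σ.1 < |((z : ℕ) : ℝ) - count q x|),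
              noise n (P.scale σ.1) (count q x) z) := by
          rw [← ENNReal.ofReal_sum_of_nonneg]
          · rw [Finset.sum_add_distrib, ← Finset.sum_mul, sum_noise, one_mul, Finset.sum_filter]
          · intro z _
            have hn := noise_nonneg n (P.scale σ.1) (count q x) z
            have := mul_nonneg hn hexp.le
            split_ifs <;> linarith
      _ ≤ _ := by
          apply ENNReal.ofReal_le_ofReal
          have := sum_noise_tail_le (n := n) (s := P.tol σ.1) hpos (count_le q x)
          rw [hmul] at this
          linarith

theorem halving_accurate (P : Schedule) (A : AdaptiveAnalyst U) (x : Dataset U n) {m : ℕ}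
    {s : Set (Transcript U m)} (hs : ∀ k t, Sound P x k t → t ∈ s) :
    ENNReal.ofReal (1 - (3 * m + 1) * Real.exp (-P.width)) ≤
      trans (halving P U n).algorithm A m x s := by
  classical
  have h := SparseMechanism.le_trans_of_good (M := halving P U n) (A := A) (x := x)
    (good := Invariant P x) (b₀ := ENNReal.ofReal (Real.exp (-P.width)))
    (b := ENNReal.ofReal (3 * Real.exp (-P.width))) (m := m) (s := s) ?_
    (fun j h r q hI => hI.step_le q) fun h r hI => hs _ _ hI.sound
  · refine le_trans (le_of_eq ?_) h
    have he := Real.exp_pos (-P.width)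
    rw [← ENNReal.ofReal_natCast m, ← ENNReal.ofReal_mul (Nat.cast_nonneg m),
      ← ENNReal.ofReal_add he.le (by positivity), ← ENNReal.ofReal_one,
      ← ENNReal.ofReal_sub _ (by positivity)]
    congr 1
    ring
  · rw [← P.scale_mul_tol 0]
    refine tsum_geometric_tail_le (P.scale_pos 0) _ fun r hr => ⟨hr, ⟨?_, ?_⟩, ?_⟩
    · exact fun i => i.elim0
    · intro k' hk'
      exact absurd hk' (Nat.not_lt_zero _)
    · exact fun y hy _ => hy

end

noncomputable section

/-! ### Hereditary discrepancy -/

variable {U : Type u} {n : ℕ}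

theorem exists_coloring [Fintype U] [DecidableEq U] {k : ℕ} (B : Matrix (Fin k) U ℝ) {w : ℕ}
    {S : Finset U} (hS : S.card ≤ w) :
    ∃ χ : U → ℤ, (∀ u ∈ S, χ u = 1 ∨ χ u = -1) ∧ (∀ u ∉ S, χ u = 0) ∧
      ∀ i, |∑ u, B i u * χ u| ≤ hdisc B w := by
  obtain ⟨z, hz⟩ := exists_eq_ciInf_of_finite (f := fun z : S → ℤˣ =>
    ‖(B.submatrix id (Subtype.val : S → U)).mulVec (fun v => (((z v : ℤˣ) : ℤ) : ℝ))‖)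
  have hle : ‖(B.submatrix id (Subtype.val : S → U)).mulVec
      (fun v => (((z v : ℤˣ) : ℤ) : ℝ))‖ ≤ hdisc B w := by
    rw [hz]
    exact le_ciSup (f := fun S : {S : Finset U // S.card ≤ w} => ⨅ x : S.1 → ℤˣ,
      ‖(B.submatrix id (Subtype.val : S.1 → U)).mulVec (fun v => (((x v : ℤˣ) : ℤ) : ℝ))‖)
      (Set.finite_range _).bddAbove ⟨S, hS⟩
  refine ⟨fun u => if h : u ∈ S then ((z ⟨u, h⟩ : ℤˣ) : ℤ) else 0, ?_, ?_, ?_⟩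
  · intro u hu
    simp only [dif_pos hu]
    rcases Int.units_eq_one_or (z ⟨u, hu⟩) with h | h <;> simp [h]
  · intro u hu
    simp [hu]
  · intro i
    have h1 := (norm_le_pi_norm _ i).trans hle
    rw [Real.norm_eq_abs] at h1
    refine le_trans (le_of_eq ?_) h1
    congr 1
    rw [← Finset.sum_subset (Finset.subset_univ S) (fun u _ hu => by simp [hu]),
      ← Finset.sum_coe_sort S]
    simp [Matrix.mulVec, dotProduct]

/-- A single column already has discrepancy 1 in the row of ones. -/
theorem one_le_hdiscStar [Fintype U] [Nonempty U] {m : ℕ} (Q : Fin m → BoolQuery U)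
    (hn : 1 ≤ n) : 1 ≤ hdiscStar Q n := by
  classical
  obtain ⟨u⟩ := ‹Nonempty U›
  obtain ⟨χ, h1, h2, h3⟩ := exists_coloring (appendOnes (queryMatrix Q)) (w := n) (S := {u})
    (by simpa using hn)
  have h4 := h3 (Fin.last m)
  rw [Finset.sum_eq_single u (fun v _ hv => by simp [h2 v (by simpa using hv)])
    (by simp)] at h4
  refine le_trans (le_of_eq ?_) h4
  rcases h1 u (by simp) with h | h <;> simp [appendOnes, h]

/-! ### Small summaries of a dataset -/

/-- Take `a' = (a + χ) / 2` with `χ` a colouring of the elements of odd multiplicity. There are at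
most `∑ a ≤ w` of these, and `a' ≤ a` keeps the bound for the next halving. -/
theorem exists_half [Fintype U] [DecidableEq U] {k : ℕ} (B : Matrix (Fin k) U ℝ) {w : ℕ}
    {a : U → ℕ} (ha : ∑ u, a u ≤ w) :
    ∃ a' : U → ℕ, ∑ u, a' u ≤ w ∧
      ∀ i, |2 * ∑ u, B i u * a' u - ∑ u, B i u * a u| ≤ hdisc B w := by
  obtain ⟨χ, h1, h2, h3⟩ := exists_coloring B (w := w)
    (S := Finset.univ.filter fun u => Odd (a u)) (by
      rw [Finset.card_eq_sum_ones]
      refine le_trans ?_ ha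
      refine le_trans (Finset.sum_le_sum fun u hu => ?_)
        (Finset.sum_le_sum_of_subset (f := a) (Finset.subset_univ _))
      exact (Finset.mem_filter.1 hu).2.pos)
  have hex : ∀ u, ∃ c : ℕ, 2 * (c : ℤ) = a u + χ u ∧ c ≤ a u := by
    intro u
    by_cases hu : Odd (a u)
    · obtain ⟨c, hc⟩ := hu
      rcases h1 u (by simp [hc]) with h | h
      · exact ⟨c + 1, by rw [h, hc]; push_cast; ring, by omega⟩
      · exact ⟨c, by rw [h, hc]; push_cast; ring, by omega⟩
    · have h := h2 u (by simpa using hu)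
      obtain ⟨c, hc⟩ := Nat.not_odd_iff_even.1 hu
      exact ⟨c, by rw [h, hc]; push_cast; ring, by omega⟩
  choose a' ha1 ha2 using hex
  refine ⟨a', (Finset.sum_le_sum fun u _ => ha2 u).trans ha, fun i => ?_⟩
  refine le_trans (le_of_eq ?_) (h3 i)
  congr 1
  rw [Finset.mul_sum, ← Finset.sum_sub_distrib]
  refine Finset.sum_congr rfl fun u _ => ?_
  have : (2 : ℝ) * a' u = a u + χ u := by exact_mod_cast ha1 u
  linear_combination B i u * this

/-- The halving numbered `i` from 0 is scaled by `2 ^ i`, and the errors add up to `1 + 2 + ⋯ + 2 ^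
(d - 1) = 2 ^ d - 1`. -/
theorem exists_iterated_half [Fintype U] [DecidableEq U] {k : ℕ} (B : Matrix (Fin k) U ℝ) {w : ℕ}
    {a : U → ℕ} (ha : ∑ u, a u ≤ w) (d : ℕ) :
    ∃ a' : U → ℕ, ∑ u, a' u ≤ w ∧
      ∀ i, |2 ^ d * ∑ u, B i u * a' u - ∑ u, B i u * a u| ≤ (2 ^ d - 1) * hdisc B w := by
  induction d with
  | zero => exact ⟨a, ha, fun i => by simp⟩
  | succ d ih =>
    obtain ⟨b, hb1, hb2⟩ := ih
    obtain ⟨c, hc1, hc2⟩ := exists_half B hb1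
    refine ⟨c, hc1, fun i => ?_⟩
    have h1 := hb2 i
    have h2 := hc2 i
    have h3 : (2 : ℝ) ^ (d + 1) * ∑ u, B i u * c u - ∑ u, B i u * a u =
        2 ^ d * (2 * ∑ u, B i u * c u - ∑ u, B i u * b u) +
          (2 ^ d * ∑ u, B i u * b u - ∑ u, B i u * a u) := by ring
    rw [h3]
    refine (abs_add_le _ _).trans ?_
    rw [abs_mul, abs_of_nonneg (by positivity : (0 : ℝ) ≤ 2 ^ d)]
    have h4 := mul_le_mul_of_nonneg_left h2 (by positivity : (0 : ℝ) ≤ 2 ^ d)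
    rw [pow_succ]
    linarith

theorem exists_summary [Fintype U] [DecidableEq U] {m : ℕ} (Q : Fin m → BoolQuery U)
    (x : Dataset U n) (d : ℕ) :
    ∃ y : Multiset U, 2 ^ d * (y.card : ℝ) ≤ n + (2 ^ d - 1) * hdiscStar Q n ∧
      ∀ j, |2 ^ d * ((y.countP fun u => Q j u = true : ℕ) : ℝ) - count (Q j) x| ≤
        (2 ^ d - 1) * hdiscStar Q n := by
  set a : U → ℕ := fun u => (Finset.univ.filter fun i => x i = u).card with ha
  have hfib : ∀ f : U → ℝ, ∑ u, f u * a u = ∑ i, f (x i) := by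
    intro f
    rw [← Finset.sum_fiberwise (s := Finset.univ) (g := x)]
    refine Finset.sum_congr rfl fun u _ => ?_
    rw [Finset.sum_congr rfl fun i hi => by rw [(Finset.mem_filter.1 hi).2], Finset.sum_const,
      nsmul_eq_mul, mul_comm]
  have hn : ∑ u, a u = n := by
    have := hfib fun _ => 1
    simp only [one_mul, Finset.sum_const, Finset.card_univ, Fintype.card_fin, nsmul_eq_mul,
      mul_one] at this
    exact_mod_cast this
  obtain ⟨b, -, hb⟩ := exists_iterated_half (appendOnes (queryMatrix Q)) hn.le d
  set y : Multiset U := ∑ u, b u • ({u} : Multiset U) with hy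
  have hcard : y.card = ∑ u, b u := by simp [hy]
  have hcount : ∀ q : BoolQuery U, ((y.countP fun u => q u = true : ℕ) : ℝ) =
      ∑ u, truth q u * b u := by
    intro q
    have h1 : y.countP (fun u => q u = true) =
        ∑ u, b u * Multiset.countP (fun u => q u = true) {u} := by
      rw [hy, ← Multiset.coe_countPAddMonoidHom, map_sum]
      refine Finset.sum_congr rfl fun u _ => ?_
      rw [map_nsmul, smul_eq_mul]
    rw [h1]
    push_cast
    refine Finset.sum_congr rfl fun u _ => ?_
    rw [mul_comm, ← Multiset.cons_zero, Multiset.countP_cons]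
    by_cases h : q u = true <;> simp [truth, h]
  refine ⟨y, ?_, fun j => ?_⟩
  · have h1 := hb (Fin.last m)
    simp only [appendOnes, Matrix.of_apply, Fin.snoc_last, one_mul] at h1
    have h2 := (abs_le.1 h1).2
    have h3 : (∑ u, (a u : ℝ)) = n := by exact_mod_cast hn
    rw [hcard]
    push_cast
    rw [h3] at h2
    unfold hdiscStar appendOnes
    linarith
  · have h1 := hb j.castSucc
    simp only [appendOnes, Matrix.of_apply, Fin.snoc_castSucc, queryMatrix] at h1
    rw [hcount, cast_count, ← hfib]
    exact h1

/-- Some hypothesis of stage `k` is accurate on the transcript. -/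
def Fits [Fintype U] [DecidableEq U] (P : Schedule) (x : Dataset U n) {m : ℕ}
    (t : Transcript U m) (k : ℕ) : Prop := ∃ y ∈ candidates U k, Accurate P x k y t

theorem fits_of_le [Fintype U] [DecidableEq U] {P : Schedule} (x : Dataset U n) {m : ℕ}
    (t : Transcript U m) {k : ℕ}
    (h1 : (n : ℝ) + (2 ^ (P.depth - k) - 1) * hdiscStar (fun j => (t j).1) n ≤
      2 ^ (P.depth - k) * 2 ^ (k + 1))
    (h2 : (2 ^ (P.depth - k) - 1) * hdiscStar (fun j => (t j).1) n ≤ P.tol k) :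
    Fits P x t k := by
  obtain ⟨y, hy1, hy2⟩ := exists_summary (fun j => (t j).1) x (P.depth - k)
  refine ⟨y, mem_smallMultisets ?_, fun j => ?_⟩
  · have h3 := le_of_mul_le_mul_left (hy1.trans h1) (by positivity)
    exact_mod_cast h3
  · have h3 := (hy2 j).trans h2
    have h4 : (count (t j).1 x : ℝ) ≤ n := by exact_mod_cast count_le _ x
    refine le_trans ?_ h3
    -- Truncation at `n` cannot increase the error, the true count being at most `n`.
    unfold guess
    push_cast
    rw [abs_le]
    have h5 := abs_le.1 (le_refl |2 ^ (P.depth - k) *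
      ((y.countP fun u => (t j).1 u = true : ℕ) : ℝ) - count (t j).1 x|)
    rcases min_cases (n : ℝ) (2 ^ (P.depth - k) *
      ((y.countP fun u => (t j).1 u = true : ℕ) : ℝ)) with ⟨h, h'⟩ | ⟨h, h'⟩
    · rw [h]; constructor <;> linarith
    · rw [h]; exact h5

/-- The first stage that fits is reached early, in terms of the discrepancy of the queries. -/
theorem exists_fits [Fintype U] [DecidableEq U] [Nonempty U] {P : Schedule} (hn : 1 ≤ n)
    (hd1 : n ≤ 2 ^ P.depth) (hd2 : 2 ^ P.depth ≤ 2 * n) (x : Dataset U n) {m : ℕ}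
    (t : Transcript U m) :
    Fits P x t 0 ∨ ∃ k, k < P.depth ∧ Fits P x t (k + 1) ∧
      2 ^ k * min 1 (P.tol k / n) ≤ 2 * hdiscStar (fun j => (t j).1) n := by
  classical
  set H := hdiscStar (fun j => (t j).1) n with hH
  have hH1 : 1 ≤ H := one_le_hdiscStar _ hn
  have hn0 : (0 : ℝ) < n := by exact_mod_cast hn
  have hd1' : (n : ℝ) ≤ 2 ^ P.depth := by exact_mod_cast hd1
  have hd2' : (2 : ℝ) ^ P.depth ≤ 2 * n := by exact_mod_cast hd2
  -- At stage `depth` the weight is 1 and no halving takes place, so the dataset itself is an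
  -- accurate hypothesis.
  have hlast : Fits P x t P.depth := by
    refine fits_of_le x t ?_ ?_
    · simp only [tsub_self, pow_zero, sub_self, zero_mul, add_zero, one_mul, pow_succ]
      linarith
    · simp only [tsub_self, pow_zero, sub_self, zero_mul]
      exact P.tol_nonneg _
  have hex : ∃ k, Fits P x t k := ⟨_, hlast⟩
  have hfit := Nat.find_spec hex
  have hle : Nat.find hex ≤ P.depth := Nat.find_min' hex hlast
  rcases hk : Nat.find hex with _ | k
  · left; rwa [hk] at hfit
  · right
    rw [hk] at hfit hle
    refine ⟨k, hle, hfit, ?_⟩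
    -- Otherwise both `2H < 2^k` and `2Hn < 2^k * tol k`: stage `k` would have room for the summary
    -- and tolerate its error, against the minimality of `k + 1`.
    by_contra hcon
    push Not at hcon
    have h2k : (0 : ℝ) < 2 ^ k := by positivity
    have hpow : (2 : ℝ) ^ (P.depth - k) * 2 ^ k = 2 ^ P.depth := by
      rw [← pow_add]; congr 1; omega
    have hc1 : 2 * H < 2 ^ k := hcon.trans_le (mul_le_of_le_one_right h2k.le (min_le_left _ _))
    have hc2 : 2 * H * n < 2 ^ k * P.tol k := by
      have := hcon.trans_le (mul_le_mul_of_nonneg_left (min_le_right _ _) h2k.le)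
      rwa [← mul_div_assoc, lt_div_iff₀ hn0] at this
    refine Nat.find_min hex (m := k) (by omega) (fits_of_le x t ?_ ?_)
    · rw [pow_succ, ← mul_assoc, hpow, ← hH]
      have h5 : (1 : ℝ) ≤ 2 ^ (P.depth - k) := one_le_pow₀ (by norm_num)
      have h6 : (2 : ℝ) ^ (P.depth - k) * H ≤ 2 ^ P.depth := by
        rw [← hpow]
        gcongr
        linarith
      linarith
    · rw [← hH]
      have h5 : (2 : ℝ) ^ (P.depth - k) * H * 2 ^ k ≤ P.tol k * 2 ^ k := by
        calc (2 : ℝ) ^ (P.depth - k) * H * 2 ^ k = 2 ^ P.depth * H := by rw [← hpow]; ring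
          _ ≤ 2 * n * H := by gcongr
          _ ≤ P.tol k * 2 ^ k := by linarith
      have h6 := le_of_mul_le_mul_right h5 h2k
      linarith

end

noncomputable section

/-! ### The error rate of the halving mechanism -/

theorem le_rpow_of_cube_le {a K F : ℝ} (ha : 0 ≤ a) (hK : 0 ≤ K) (hF : 0 ≤ F)
    (h : a ^ 3 ≤ K * F ^ 2) : a ≤ K ^ (1 / 3 : ℝ) * F ^ (2 / 3 : ℝ) := by
  have h1 : F ^ (2 / 3 : ℝ) = (F ^ 2) ^ (1 / 3 : ℝ) := by
    rw [← Real.rpow_natCast F 2, ← Real.rpow_mul hF]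
    norm_num
  rw [h1, ← Real.mul_rpow hK (by positivity)]
  have h2 : a = (a ^ 3) ^ (1 / 3 : ℝ) := by
    rw [← Real.rpow_natCast a 3, ← Real.rpow_mul ha]
    norm_num
  rw [h2]
  exact Real.rpow_le_rpow (by positivity) h (by norm_num)

theorem one_lt_log_of_three_le {n : ℕ} (hn : 3 ≤ n) : 1 < Real.log n := by
  have h3 : (3 : ℝ) ≤ n := by exact_mod_cast hn
  rw [Real.lt_log_iff_exp_lt (by linarith)]
  exact Real.exp_one_lt_three.trans_le h3

theorem log_log_three_pos : 0 < Real.log (Real.log 3) :=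
  Real.log_pos (by simpa using one_lt_log_of_three_le le_rfl)

/-- The factor `log n > 1` keeps this logarithm away from 0 even for `m = 1` and `β` near 1, so it
can absorb additive constants. -/
theorem log_log_three_le {n m : ℕ} {β : ℝ} (hn : 3 ≤ n) (hm : 1 ≤ m) (hβ : 0 < β) (hβ1 : β < 1) :
    Real.log (Real.log 3) + Real.log (m / β) ≤ Real.log (m * Real.log n / β) := by
  have h1 := one_lt_log_of_three_le hn
  have hm' : (1 : ℝ) ≤ m := by exact_mod_cast hm
  have h3 : Real.log 3 ≤ Real.log n := Real.log_le_log (by norm_num) (by exact_mod_cast hn)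
  have h4 : Real.log (Real.log 3) ≤ Real.log (Real.log n) :=
    Real.log_le_log (by linarith [one_lt_log_of_three_le (n := 3) le_rfl, (by norm_num :
      ((3 : ℕ) : ℝ) = 3), Real.log_pos (by norm_num : (1 : ℝ) < 3)]) h3
  have h5 : (m : ℝ) * Real.log n / β = Real.log n * (m / β) := by ring
  rw [h5, Real.log_mul (by linarith) (by positivity)]
  linarith

theorem log_div_nonneg {m : ℕ} {β : ℝ} (hm : 1 ≤ m) (hβ : 0 < β) (hβ1 : β < 1) :
    0 ≤ Real.log (m / β) := by
  have hm' : (1 : ℝ) ≤ m := by exact_mod_cast hm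
  exact Real.log_nonneg (by rw [le_div_iff₀ hβ]; linarith)

theorem log_rate_pos {n m : ℕ} {β : ℝ} (hn : 3 ≤ n) (hm : 1 ≤ m) (hβ : 0 < β) (hβ1 : β < 1) :
    0 < Real.log (m * Real.log n / β) := by
  linarith [log_log_three_le hn hm hβ hβ1, log_div_nonneg hm hβ hβ1, log_log_three_pos]

theorem log_four_mul_le {n m : ℕ} {β : ℝ} (hn : 3 ≤ n) (hm : 1 ≤ m) (hβ : 0 < β) (hβ1 : β < 1) :
    Real.log (4 * m / β) ≤
      (Real.log 4 / Real.log (Real.log 3) + 1) * Real.log (m * Real.log n / β) := by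
  have h1 := log_log_three_le hn hm hβ hβ1
  have h2 := log_div_nonneg hm hβ hβ1
  have h3 := log_log_three_pos
  have hm' : (1 : ℝ) ≤ m := by exact_mod_cast hm
  have h4 : 0 < Real.log 4 := Real.log_pos (by norm_num)
  have h5 : Real.log (4 * m / β) = Real.log 4 + Real.log (m / β) := by
    rw [mul_div_assoc, Real.log_mul (by norm_num) (by positivity)]
  have h6 : Real.log 4 ≤
      Real.log 4 / Real.log (Real.log 3) * Real.log (m * Real.log n / β) := by
    rw [div_mul_eq_mul_div, le_div_iff₀ h3]
    exact mul_le_mul_of_nonneg_left (by linarith) h4.le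
  rw [h5, add_mul, one_mul]
  linarith

theorem clog_add_two_le {n : ℕ} (hn : 3 ≤ n) :
    (Nat.clog 2 n : ℝ) + 2 ≤ (3 + 1 / Real.log 2) * Real.log n := by
  have h1 := one_lt_log_of_three_le hn
  have hn0 : (0 : ℝ) < n := by positivity
  have h2 : 0 < Real.log 2 := Real.log_pos (by norm_num)
  have h3 : 2 ^ (Nat.clog 2 n - 1) < n := by
    have := Nat.pow_pred_clog_lt_self one_lt_two (x := n) (by omega)
    simpa using this
  have hc : 1 ≤ Nat.clog 2 n := Nat.clog_pos one_lt_two (by omega)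
  have h4 : ((Nat.clog 2 n - 1 : ℕ) : ℝ) * Real.log 2 ≤ Real.log n := by
    rw [← Real.log_pow]
    exact Real.log_le_log (by positivity) (by exact_mod_cast h3.le)
  rw [Nat.cast_sub hc] at h4
  have h5 : (Nat.clog 2 n : ℝ) - 1 ≤ 1 / Real.log 2 * Real.log n := by
    rw [one_div, ← div_eq_inv_mul, le_div_iff₀ h2]
    exact_mod_cast h4
  rw [add_mul]
  linarith

variable {U : Type u}

theorem log_card_candidates_le [Fintype U] [DecidableEq U] (hU : 2 ≤ Fintype.card U) (k : ℕ) :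
    (Nat.log 2 (candidates U k).card : ℝ) + 1 ≤ 8 * (2 ^ k * Real.log (Fintype.card U)) := by
  set N := Fintype.card U with hN
  have hN' : (2 : ℝ) ≤ N := by exact_mod_cast hU
  have h2 : 0.69 < Real.log 2 := by linarith [Real.log_two_gt_d9]
  have hl : Real.log 2 ≤ Real.log N := Real.log_le_log (by norm_num) hN'
  have h1 : (Nat.log 2 (candidates U k).card : ℝ) * Real.log 2 ≤ 4 * (2 ^ k * Real.log N) := by
    rcases Nat.eq_zero_or_pos (candidates U k).card with h0 | h0
    · rw [h0]
      simp only [Nat.log_zero_right, Nat.cast_zero, zero_mul]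
      have : 0 ≤ Real.log N := by linarith
      positivity
    rw [← Real.log_pow]
    have h3 : 2 ^ Nat.log 2 (candidates U k).card ≤ (N + 1) ^ 2 ^ (k + 1) :=
      (Nat.pow_log_le_self 2 h0.ne').trans (card_smallMultisets_le _)
    -- `N + 1 ≤ N²` for `N ≥ 2`.
    have h4 : ((2 : ℝ) ^ Nat.log 2 (candidates U k).card) ≤ ((N : ℝ) ^ 2) ^ 2 ^ (k + 1) := by
      refine le_trans (b := ((N : ℝ) + 1) ^ 2 ^ (k + 1)) (by exact_mod_cast h3) ?_
      exact pow_le_pow_left₀ (by positivity) (by nlinarith) _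
    refine (Real.log_le_log (by positivity) h4).trans (le_of_eq ?_)
    rw [Real.log_pow, Real.log_pow]
    push_cast
    ring
  have h5 : (1 : ℝ) ≤ 2 ^ k := one_le_pow₀ (by norm_num)
  have h6 : Real.log N ≤ 2 ^ k * Real.log N := le_mul_of_one_le_left (by linarith) h5
  have h7 : (0 : ℝ) ≤ Nat.log 2 (candidates U k).card := by positivity
  nlinarith

/-- The schedule with which the halving mechanism attains its rate. -/
def rateSchedule (n : ℕ) (c ε D lN : ℝ) (w : ℝ) (hc : 0 < c) (hε : 0 < ε) (hD : 0 < D)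
    (hN : 0 < lN) (hw : 0 ≤ w) : Schedule where
  depth := Nat.clog 2 n
  scale k := ε / (c * (k + 2) * Real.sqrt (D * (2 ^ k * lN)))
  scale_pos k := by positivity
  scale_anti := by
    intro i j hij
    have h1 : (i : ℝ) ≤ j := by exact_mod_cast hij
    have h2 : (2 : ℝ) ^ i ≤ 2 ^ j := pow_le_pow_right₀ (by norm_num) hij
    dsimp only
    gcongr
  width := w
  width_nonneg := hw

theorem rateSchedule_budget [Fintype U] [DecidableEq U] (hU : 2 ≤ Fintype.card U) {n : ℕ}
    {κ ε D w : ℝ} (hκ : 0 < κ) (hε : 0 < ε) (hD : 0 < D)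
    (hN : 0 < Real.log (Fintype.card U)) (hw : 0 ≤ w) {l : ℕ} (hl : (l + 1 : ℝ) ≤ κ * D / ε)
    (k : ℕ) :
    (l + 1) ^ 2 * (5 * (rateSchedule n (10 * κ) ε D (Real.log (Fintype.card U)) w
      (by positivity) hε hD hN hw).scale k) ^ 2 / 2 *
        (Nat.log 2 (candidates U k).card + 1) ≤ D / ((k + 1) * (k + 2)) := by
  set lN := Real.log (Fintype.card U)
  have h1 := log_card_candidates_le hU k
  change (l + 1 : ℝ) ^ 2 * (5 * (ε / (10 * κ * (k + 2) * Real.sqrt (D * (2 ^ k * lN))))) ^ 2 / 2 *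
    _ ≤ _
  have hsq : Real.sqrt (D * (2 ^ k * lN)) ^ 2 = D * (2 ^ k * lN) := Real.sq_sqrt (by positivity)
  -- The 10 in the schedule makes the numerical factor `25 * 8 / (2 * 10²)` equal to 1.
  calc _ ≤ (κ * D / ε) ^ 2 *
        (5 * (ε / (10 * κ * (k + 2) * Real.sqrt (D * (2 ^ k * lN))))) ^ 2 / 2 *
        (8 * (2 ^ k * lN)) := by
        gcongr
    _ = D / (k + 2) ^ 2 := by
        rw [mul_pow 5, div_pow ε, mul_pow _ (Real.sqrt _), hsq]
        field_simp
        ring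
    _ ≤ _ := by
        gcongr
        nlinarith

theorem rateSchedule_tol {n k : ℕ} {c ε D lN w : ℝ} (hc : 0 < c) (hε : 0 < ε) (hD : 0 < D)
    (hN : 0 < lN) (hw : 0 ≤ w) :
    (rateSchedule n c ε D lN w hc hε hD hN hw).tol k =
      w * c * (k + 2) * Real.sqrt (D * (2 ^ k * lN)) / ε := by
  change w / (ε / (c * (k + 2) * Real.sqrt (D * (2 ^ k * lN)))) = _
  rw [div_div_eq_mul_div]
  ring

theorem rateSchedule_tol_succ_le {n k : ℕ} {c ε D lN w : ℝ} (hc : 0 < c) (hε : 0 < ε)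
    (hD : 0 < D) (hN : 0 < lN) (hw : 0 ≤ w) :
    (rateSchedule n c ε D lN w hc hε hD hN hw).tol (k + 1) ≤
      3 * (rateSchedule n c ε D lN w hc hε hD hN hw).tol k := by
  rw [rateSchedule_tol, rateSchedule_tol]
  have h1 : Real.sqrt (D * (2 ^ (k + 1) * lN)) ≤ 2 * Real.sqrt (D * (2 ^ k * lN)) := by
    rw [← Real.sqrt_sq (by norm_num : (0 : ℝ) ≤ 2), ← Real.sqrt_mul (by positivity)]
    apply Real.sqrt_le_sqrt
    rw [pow_succ]
    have : 0 < D * (2 ^ k * lN) := by positivity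
    rw [Real.sqrt_sq (by norm_num)]
    nlinarith
  have h2 : ((k + 1 : ℕ) : ℝ) + 2 ≤ 3 / 2 * (k + 2) := by
    push_cast
    have : (0 : ℝ) ≤ k := by positivity
    linarith
  calc _ ≤ w * c * (3 / 2 * (k + 2)) * (2 * Real.sqrt (D * (2 ^ k * lN))) / ε := by gcongr
    _ = _ := by ring

/-- The error bound, given the first stage that fits. -/
theorem error_le_of_stage {n m k : ℕ} (hn : 3 ≤ n) (hm : 1 ≤ m) {c ε δ β H : ℝ} {N : ℕ}
    (hN : 0 < Real.log N) (hc : 0 < c) (hε : 0 < ε) (hD : 0 < Real.log (1 / δ)) (hβ : 0 < β)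
    (hβ1 : β < 1) (hw : 0 ≤ Real.log (4 * m / β)) (hk : k ≤ Nat.clog 2 n)
    {μ : ℝ} (hμ0 : 0 ≤ μ) (hμ : μ ≤ (rateSchedule n c ε (Real.log (1 / δ))
      (Real.log N) (Real.log (4 * m / β)) hc hε hD hN hw).tol k / n) (hH : 2 ^ k * μ ≤ 2 * H) :
    μ ≤ (2 * (c * (Real.log 4 / Real.log (Real.log 3) + 1) * (3 + 1 / Real.log 2)) ^ 2) ^
      (1 / 3 : ℝ) * errorRate H N n m ε δ β ^ (2 / 3 : ℝ) := by
  set D := Real.log (1 / δ)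
  set lN := Real.log N
  set C₂ := Real.log 4 / Real.log (Real.log 3) + 1 with hC₂
  set C₃ := 3 + 1 / Real.log 2 with hC₃
  set L := Real.log (m * Real.log n / β) with hL
  have hL0 : 0 < L := log_rate_pos hn hm hβ hβ1
  have hln := one_lt_log_of_three_le hn
  have hn0 : (0 : ℝ) < n := by positivity
  have hH0 : 0 ≤ H := by
    have : 0 ≤ 2 ^ k * μ := by positivity
    linarith
  have hC₂0 : 0 ≤ C₂ := by
    have := log_log_three_pos
    have := Real.log_pos (by norm_num : (1 : ℝ) < 4)
    positivity
  have hC₃0 : 0 ≤ C₃ := by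
    have := Real.log_pos (by norm_num : (1 : ℝ) < 2)
    positivity
  have hF : errorRate H N n m ε δ β =
      Real.sqrt (H * lN * D) * L * Real.log n / (ε * n) := rfl
  have hF0 : 0 ≤ errorRate H N n m ε δ β := by
    rw [hF]; positivity
  refine le_rpow_of_cube_le hμ0 (by positivity) hF0 ?_
  rw [rateSchedule_tol] at hμ
  have h1 : μ ≤ c * C₂ * C₃ * L * Real.log n * Real.sqrt (D * (2 ^ k * lN)) / (ε * n) := by
    refine hμ.trans ?_
    rw [div_div]
    have h2 := log_four_mul_le hn hm hβ hβ1
    have h3 : (k : ℝ) + 2 ≤ C₃ * Real.log n := by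
      refine le_trans ?_ (clog_add_two_le hn)
      gcongr
    calc _ ≤ (C₂ * L) * c * (C₃ * Real.log n) * Real.sqrt (D * (2 ^ k * lN)) / (ε * n) := by
          gcongr
      _ = _ := by ring
  have h2 : μ ^ 2 ≤ (c * C₂ * C₃ * L * Real.log n / (ε * n)) ^ 2 * (D * lN) * 2 ^ k := by
    calc μ ^ 2 ≤ (c * C₂ * C₃ * L * Real.log n * Real.sqrt (D * (2 ^ k * lN)) / (ε * n)) ^ 2 := by
          gcongr
      _ = _ := by
          rw [div_pow, mul_pow _ (Real.sqrt _), Real.sq_sqrt (by positivity), div_pow]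
          ring
  -- The spare factor `μ` turns the unknown `2 ^ k` into `2 ^ k * μ ≤ 2 * H`.
  calc μ ^ 3 = μ ^ 2 * μ := by ring
    _ ≤ (c * C₂ * C₃ * L * Real.log n / (ε * n)) ^ 2 * (D * lN) * 2 ^ k * μ := by gcongr
    _ = (c * C₂ * C₃ * L * Real.log n / (ε * n)) ^ 2 * (D * lN) * (2 ^ k * μ) := by ring
    _ ≤ (c * C₂ * C₃ * L * Real.log n / (ε * n)) ^ 2 * (D * lN) * (2 * H) := by gcongr
    _ = _ := by
        rw [hF, div_pow, div_pow, mul_pow (Real.sqrt _ * L), mul_pow (Real.sqrt _),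
          Real.sq_sqrt (by positivity)]
        ring

/-- The absolute constants in the error bound. -/
def rateConst (δ₀ : ℝ) : ℝ :=
  15 * (2 * (10 * (2 + 2 / Real.log (1 / δ₀)) * (Real.log 4 / Real.log (Real.log 3) + 1) *
    (3 + 1 / Real.log 2)) ^ 2) ^ (1 / 3 : ℝ)

theorem rateConst_pos {δ₀ : ℝ} (h0 : 0 < δ₀) (h1 : δ₀ < 1) : 0 < rateConst δ₀ := by
  have h2 := log_log_three_pos
  have h3 := Real.log_pos (by norm_num : (1 : ℝ) < 4)
  have h4 := Real.log_pos (by norm_num : (1 : ℝ) < 2)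
  have h5 : 0 < Real.log (1 / δ₀) := Real.log_pos (by rw [lt_div_iff₀ h0]; linarith)
  unfold rateConst
  positivity

theorem exists_private_of_two_le_card [Fintype U] (hU : 2 ≤ Fintype.card U) {n m : ℕ}
    {δ₀ ε δ β : ℝ} (hδ₀ : δ₀ < 1) (hn : 3 ≤ n) (hm : 1 ≤ m) (hε : 0 < ε)
    (hε1 : ε ≤ 1) (hδ : 0 < δ) (hδδ₀ : δ ≤ δ₀) (hβ : 0 < β) (hβ1 : β < 1) :
    ∃ M : InteractiveAlgorithm U n, M.IsPrivate m ε δ ∧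
      ∀ (A : AdaptiveAnalyst U) (x : Dataset U n), ENNReal.ofReal (1 - β) ≤
        trans M A m x {t | maxError (fun j => (t j).1) (fun j => (t j).2) x ≤
          rateConst δ₀ * errorRate (hdiscStar (fun j => (t j).1) n) (Fintype.card U) n m ε δ β
            ^ (2 / 3 : ℝ)} := by
  classical
  have hNe : Nonempty U := Fintype.card_pos_iff.1 (by omega)
  have hm' : (1 : ℝ) ≤ m := by exact_mod_cast hm
  have hn0 : (0 : ℝ) < n := by positivity
  have hN : 0 < Real.log (Fintype.card U) :=
    Real.log_pos (by exact_mod_cast (by omega : 1 < Fintype.card U))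
  have hδ₀0 : 0 < δ₀ := hδ.trans_le hδδ₀
  have hD₀ : 0 < Real.log (1 / δ₀) := Real.log_pos (by rw [lt_div_iff₀ hδ₀0]; linarith)
  have hDD : Real.log (1 / δ₀) ≤ Real.log (1 / δ) :=
    Real.log_le_log (by positivity) (one_div_le_one_div_of_le hδ hδδ₀)
  have hD : 0 < Real.log (1 / δ) := hD₀.trans_le hDD
  have hw : 0 ≤ Real.log (4 * m / β) :=
    Real.log_nonneg (by rw [le_div_iff₀ hβ]; linarith)
  set D := Real.log (1 / δ) with hDdef
  set κ := 2 + 2 / Real.log (1 / δ₀) with hκ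
  have hκ0 : 0 < κ := by positivity
  set P := rateSchedule n (10 * κ) ε D (Real.log (Fintype.card U)) (Real.log (4 * m / β))
    (by positivity) hε hD hN hw with hP
  -- The total budget is `D = log (1/δ)`, so order `l ≥ 2D / ε` gives `exp (D - l ε) ≤ exp (-D) =
  -- δ`. The constant `κ` absorbs the rounding, using `ε ≤ 1` and `D ≥ log (1/δ₀)`.
  set l := ⌈2 * D / ε⌉₊ with hl
  have hl1 : 2 * D / ε ≤ l := Nat.le_ceil _
  have hl2 : (l : ℝ) + 1 ≤ κ * D / ε := by
    have h1 : (l : ℝ) < 2 * D / ε + 1 := Nat.ceil_lt_add_one (by positivity)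
    have h2 : 2 ≤ 2 / Real.log (1 / δ₀) * D / ε := by
      rw [le_div_iff₀ hε, div_mul_eq_mul_div, le_div_iff₀ hD₀]
      nlinarith
    rw [hκ, add_mul, add_div]
    linarith
  refine ⟨(halving P U n).algorithm, ?_, fun A x => ?_⟩
  · have hB := rateSchedule_budget hU (n := n) hκ0 hε hD hN hw hl2
    refine SparseMechanism.isPrivate (halving_budget hD.le hB)
      (fun x x' hx => halving_dominated P hx) ?_ m
    have h1 : budget P l D (halving P U n).start ≤ D / ((0 : ℕ) + 1) :=
      budget_candidates_le (hB 0)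
    have h2 : 2 * D ≤ l * ε := by rwa [div_le_iff₀ hε] at hl1
    calc _ ≤ Real.exp (-D) := Real.exp_le_exp.2 (by simp at h1; linarith)
      _ = δ := by
        rw [hDdef, one_div, Real.log_inv, neg_neg, Real.exp_log hδ]
  · refine le_trans (ENNReal.ofReal_le_ofReal ?_) (halving_accurate P A x (m := m) ?_)
    -- With this width the failure probability is `(3m + 1) β / (4m) ≤ β`.
    · change _ ≤ 1 - (3 * (m : ℝ) + 1) * Real.exp (-Real.log (4 * m / β))
      rw [Real.exp_neg, Real.exp_log (by positivity), inv_div]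
      have : (3 * (m : ℝ) + 1) * (β / (4 * m)) ≤ β := by
        rw [← mul_div_assoc, div_le_iff₀ (by positivity)]
        nlinarith
      linarith
    · intro k t hS
      change maxError _ _ x ≤ _
      set H := hdiscStar (fun j => (t j).1) n with hH
      have hH1 : 1 ≤ H := one_le_hdiscStar _ (by omega)
      -- The current stage has not passed any stage that fits, and tolerances increase with the
      -- stage.
      have herr : ∀ k', Fits P x t k' →
          maxError (fun j => (t j).1) (fun j => (t j).2) x ≤ min (5 * P.tol k' / n) 1 := by
        rintro k' ⟨y, hy, hacc⟩
        have hk : k ≤ k' := by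
          by_contra h
          exact hS.earlier k' (by omega) y hy hacc
        refine (pi_norm_le_iff_of_nonneg ?_).2 fun i => ?_
        · exact le_min (div_nonneg (mul_nonneg (by norm_num) (P.tol_nonneg _)) hn0.le) zero_le_one
        · rw [Real.norm_eq_abs]
          exact (hS.near i).trans (min_le_min_right _ (by gcongr; exact P.tol_mono hk))
      have hd1 : n ≤ 2 ^ P.depth := Nat.le_pow_clog one_lt_two n
      have hd2 : 2 ^ P.depth ≤ 2 * n := by
        have h1 : 2 ^ (Nat.clog 2 n - 1) < n := by
          simpa using Nat.pow_pred_clog_lt_self one_lt_two (x := n) (by omega)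
        have h2 : 1 ≤ Nat.clog 2 n := Nat.clog_pos one_lt_two (by omega)
        have h3 : 2 ^ P.depth = 2 * 2 ^ (Nat.clog 2 n - 1) := by
          rw [← pow_succ']
          congr 1
          change Nat.clog 2 n = _
          omega
        omega
      have hstage : ∀ k', k' ≤ Nat.clog 2 n → 2 ^ k' * min 1 (P.tol k' / n) ≤ 2 * H →
          15 * min 1 (P.tol k' / n) ≤ rateConst δ₀ * errorRate H (Fintype.card U) n m ε δ β
            ^ (2 / 3 : ℝ) := by
        intro k' hk' hμ
        rw [rateConst, mul_assoc]
        exact mul_le_mul_of_nonneg_left (error_le_of_stage hn hm hN (by positivity) hε hD hβ hβ1 hw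
          hk' (le_min zero_le_one (div_nonneg (P.tol_nonneg _) hn0.le))
          (min_le_right _ _) hμ) (by norm_num)
      rcases exists_fits (by omega) hd1 hd2 x t with h0 | ⟨k', hk', hfit, hμ⟩
      · refine le_trans ((herr 0 h0).trans ?_) (hstage 0 (Nat.zero_le _) ?_)
        · have := div_nonneg (P.tol_nonneg 0) hn0.le
          rw [mul_div_assoc]
          rcases min_cases 1 (P.tol 0 / n) with ⟨h, -⟩ | ⟨h, -⟩ <;> rw [h]
          · exact (min_le_right _ _).trans (by norm_num)
          · exact (min_le_left _ _).trans (by linarith)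
        · have : min 1 (P.tol 0 / n) ≤ 1 := min_le_left _ _
          simp only [pow_zero, one_mul]
          linarith
      · refine le_trans ((herr _ hfit).trans ?_) (hstage k' hk'.le hμ)
        -- The balance controls stage `k'`, one before the first that fits; this step costs a factor
        -- 3, whence `15 = 5 * 3`.
        have h1 : P.tol (k' + 1) ≤ 3 * P.tol k' := rateSchedule_tol_succ_le _ hε hD hN hw
        rcases min_cases 1 (P.tol k' / n) with ⟨h, -⟩ | ⟨h, -⟩ <;> rw [h]
        · exact (min_le_right _ _).trans (by norm_num)
        · refine (min_le_left _ _).trans ?_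
          rw [← mul_div_assoc]
          exact div_le_div_of_nonneg_right (by linarith) hn0.le

/-! ### Universes with at most one element -/

/-- The mechanism for a universe with at most one element, which need not look at its input. -/
def exactMechanism (U : Type u) (n : ℕ) : SparseMechanism U n PUnit where
  start := PUnit.unit
  fresh _ := PMF.pure 0
  outcome _ _ _ _ := PMF.pure none
  next σ _ _ := σ
  reply _ q _ := open Classical in
    if h : Nonempty (Dataset U n) then queryValue q h.some else 0

/-- Here `log N = 0` and the rate vanishes, so the answers must be exact. This is possible because
there is at most one dataset and there are no neighbours. -/
theorem exists_private_of_subsingleton [Fintype U] [Subsingleton U] {n m : ℕ} {ε δ β : ℝ}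
    {f : Transcript U m → ℝ} (hβ : 0 < β) (hf : ∀ t, 0 ≤ f t) :
    ∃ M : InteractiveAlgorithm U n, M.IsPrivate m ε δ ∧
      ∀ (A : AdaptiveAnalyst U) (x : Dataset U n), ENNReal.ofReal (1 - β) ≤
        trans M A m x {t | maxError (fun j => (t j).1) (fun j => (t j).2) x ≤ f t} := by
  classical
  refine ⟨(exactMechanism U n).algorithm, ?_, fun A x => ?_⟩
  · rintro A x x' ⟨i, hi, -⟩
    exact absurd (Subsingleton.elim _ _) hi
  have hreply : ∀ q o, (exactMechanism U n).reply PUnit.unit q o = queryValue q x := by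
    intro q o
    have hne : Nonempty (Dataset U n) := ⟨x⟩
    simp only [exactMechanism, dif_pos hne]
    congr 1
    exact Subsingleton.elim _ _
  have h := SparseMechanism.le_trans_of_good (M := exactMechanism U n) (A := A) (x := x)
    (good := fun j h _ => ∀ i, ((exactMechanism U n).record j h i).2 =
      queryValue ((exactMechanism U n).record j h i).1 x) (b₀ := 0)
    (b := 0) (m := m)
    (s := {t | maxError (fun j => (t j).1) (fun j => (t j).2) x ≤ f t}) ?_ ?_ ?_
  · refine le_trans ?_ h
    simp only [mul_zero, add_zero, tsub_zero]
    exact ENNReal.ofReal_le_one.2 (by linarith)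
  · refine le_of_eq (ENNReal.tsum_eq_zero.2 fun r => if_pos fun i => i.elim0)
  · intro j h r q hg
    refine le_of_eq (Finset.sum_eq_zero fun o _ => ?_)
    rw [mul_eq_zero]
    right
    refine ENNReal.tsum_eq_zero.2 fun r' => if_pos fun i => ?_
    simp only [SparseMechanism.record]
    refine Fin.lastCases ?_ (fun i => ?_) i
    · rw [Fin.snoc_last]; exact hreply q o
    · rw [Fin.snoc_castSucc]; exact hg i
  · intro h r hg
    change maxError _ _ x ≤ _
    refine le_trans (le_of_eq ?_) (hf _)
    rw [maxError, norm_eq_zero]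
    funext i
    simp [hg i]

end

noncomputable section

variable {U : Type u} {n : ℕ}

/-! ### Partial colourings -/

theorem hdisc_le_of_coloring [Fintype U] [DecidableEq U] {k : ℕ} {B : Matrix (Fin k) U ℝ} {w : ℕ}
    {b : ℝ} (hb : 0 ≤ b) (h : ∀ S : Finset U, S.card ≤ w → ∃ χ : U → ℤ,
      (∀ u ∈ S, χ u = 1 ∨ χ u = -1) ∧ (∀ u ∉ S, χ u = 0) ∧ ∀ i, |∑ u, B i u * χ u| ≤ b) :
    hdisc B w ≤ b := by
  have : Nonempty {S : Finset U // S.card ≤ w} := ⟨⟨∅, by simp⟩⟩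
  refine ciSup_le fun ⟨S, hS⟩ => ?_
  obtain ⟨χ, h1, h2, h3⟩ := h S hS
  refine (ciInf_le (Set.finite_range _).bddBelow
    (fun v : S => if χ v = 1 then (1 : ℤˣ) else -1)).trans ?_
  refine (pi_norm_le_iff_of_nonneg hb).2 fun i => ?_
  rw [Real.norm_eq_abs]
  refine le_trans (le_of_eq ?_) (h3 i)
  congr 1
  rw [← Finset.sum_subset (Finset.subset_univ S) (fun u _ hu => by simp [h2 u hu]),
    ← Finset.sum_coe_sort S]
  simp only [Matrix.mulVec, dotProduct, Matrix.submatrix_apply, id_eq]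
  refine Finset.sum_congr rfl fun v _ => ?_
  rcases h1 v v.2 with h | h <;> simp [h]

/-- If all sets of at least two columns have good partial colourings, then all sets of columns
have good colourings. -/
theorem exists_coloring_of_partial [Fintype U] [DecidableEq U] {k : ℕ} {B : Matrix (Fin k) U ℝ}
    (hB : ∀ i u, |B i u| ≤ 1) {w : ℕ} {b : ℝ} (hb : 0 ≤ b)
    (h : ∀ S : Finset U, 2 ≤ S.card → S.card ≤ w → ∃ χ : U → ℤ,
      (∀ u, χ u = 0 ∨ χ u = 1 ∨ χ u = -1) ∧ (∀ u ∉ S, χ u = 0) ∧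
      S.card ≤ 8 * (S.filter fun u => χ u ≠ 0).card ∧ ∀ i, |∑ u, B i u * χ u| ≤ b) (r : ℕ) :
    ∀ S : Finset U, S.card ≤ w → S.card * 7 ^ r < 2 * 8 ^ r → ∃ χ : U → ℤ,
      (∀ u ∈ S, χ u = 1 ∨ χ u = -1) ∧ (∀ u ∉ S, χ u = 0) ∧
        ∀ i, |∑ u, B i u * χ u| ≤ b * r + 1 := by
  have hone : ∀ (r : ℕ) (S : Finset U), S.card < 2 → ∃ χ : U → ℤ,
      (∀ u ∈ S, χ u = 1 ∨ χ u = -1) ∧ (∀ u ∉ S, χ u = 0) ∧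
        ∀ i, |∑ u, B i u * χ u| ≤ b * r + 1 := by
    intro r S hS
    refine ⟨fun u => if u ∈ S then 1 else 0, fun u hu => by simp [hu], fun u hu => by simp [hu],
      fun i => ?_⟩
    have h1 : |∑ u, B i u * ((if u ∈ S then 1 else 0 : ℤ) : ℝ)| ≤ 1 := by
      have h2 : ∑ u, B i u * ((if u ∈ S then 1 else 0 : ℤ) : ℝ) = ∑ u ∈ S, B i u := by
        simp [Finset.sum_ite_mem]
      rw [h2]
      refine (Finset.abs_sum_le_sum_abs _ _).trans
        ((Finset.sum_le_card_nsmul _ _ 1 fun u _ => hB i u).trans ?_)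
      rw [nsmul_eq_mul, mul_one]
      exact_mod_cast (by omega : S.card ≤ 1)
    have : 0 ≤ b * r := by positivity
    linarith
  induction r with
  | zero => intro S _ hS; exact hone 0 S (by simpa using hS)
  | succ r ih =>
    intro S hSw hS
    rcases lt_or_ge S.card 2 with h2 | h2
    · exact hone _ S h2
    obtain ⟨χ, hχ1, hχ2, hχ3, hχ4⟩ := h S h2 hSw
    -- At most seven eighths of the columns stay uncoloured; they are coloured by induction and the
    -- two disjointly supported colourings are added.
    set S' := S.filter fun u => ¬ χ u ≠ 0 with hS'
    have hcard := Finset.card_filter_add_card_filter_not (s := S) (fun u => χ u ≠ 0)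
    rw [← hS'] at hcard
    obtain ⟨χ', h1', h2', h3'⟩ := ih S' (by omega) (by
      have h8 : S'.card * 8 ≤ S.card * 7 := by omega
      have h9 : S'.card * 8 * 7 ^ r ≤ S.card * 7 * 7 ^ r := Nat.mul_le_mul_right _ h8
      rw [pow_succ, pow_succ] at hS
      nlinarith)
    refine ⟨fun u => χ u + χ' u, fun u hu => ?_, fun u hu => ?_, fun i => ?_⟩
    · by_cases h0 : χ u = 0
      · have := h1' u (by simp [hS', hu, h0])
        simpa [h0] using this
      · have h3 := h2' u (by simp [hS', h0])
        have := hχ1 u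
        simp only [h3, add_zero]
        tauto
    · simp [hχ2 u hu, h2' u (by simp [hS', hu])]
    · have h5 : ∑ u, B i u * ((χ u + χ' u : ℤ) : ℝ) =
          ∑ u, B i u * χ u + ∑ u, B i u * χ' u := by
        rw [← Finset.sum_add_distrib]
        refine Finset.sum_congr rfl fun u _ => ?_
        push_cast
        ring
      rw [h5]
      refine (abs_add_le _ _).trans ?_
      have := hχ4 i
      have := h3' i
      push_cast
      linarith

theorem mul_seven_eighths_pow_lt {n : ℕ} (hn : 3 ≤ n) :
    n * 7 ^ ⌈8 * Real.log n⌉₊ < 2 * 8 ^ ⌈8 * Real.log n⌉₊ := by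
  set r := ⌈8 * Real.log n⌉₊ with hr
  have hn0 : (0 : ℝ) < n := by positivity
  have h1 : 8 * Real.log n ≤ r := Nat.le_ceil _
  have h2 : (7 / 8 : ℝ) ^ r ≤ 1 / n := by
    have h3 : (7 / 8 : ℝ) ≤ Real.exp (-(1 / 8)) := by
      have := Real.add_one_le_exp (-(1 / 8 : ℝ))
      linarith
    calc (7 / 8 : ℝ) ^ r ≤ Real.exp (-(1 / 8)) ^ r := pow_le_pow_left₀ (by norm_num) h3 r
      _ = Real.exp (r * -(1 / 8)) := (Real.exp_nat_mul _ _).symm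
      _ ≤ Real.exp (-Real.log n) := Real.exp_le_exp.2 (by linarith)
      _ = 1 / n := by rw [Real.exp_neg, Real.exp_log hn0, one_div]
  rw [div_pow, div_le_div_iff₀ (by positivity) hn0, one_mul] at h2
  have h3 : 7 ^ r * n ≤ 8 ^ r := by exact_mod_cast h2
  have h4 : 0 < 8 ^ r := by positivity
  rw [mul_comm]
  omega

theorem abs_appendOnes_le {m : ℕ} (Q : Fin m → BoolQuery U) (i : Fin (m + 1)) (u : U) :
    |appendOnes (queryMatrix Q) i u| ≤ 1 := by
  refine Fin.lastCases ?_ (fun i => ?_) i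
  · simp [appendOnes]
  · simp only [appendOnes, Matrix.of_apply, Fin.snoc_castSucc, queryMatrix, truth]
    split_ifs <;> simp

/-- A set of columns on which every large partial colouring has large discrepancy. -/
theorem exists_rigid_set [Fintype U] [DecidableEq U] {m : ℕ} {Q : Fin m → BoolQuery U}
    (hn : 3 ≤ n) (hH : 2 ≤ hdiscStar Q n) :
    ∃ S : Finset U, 2 ≤ S.card ∧ S.card ≤ n ∧ ∀ χ : U → ℤ,
      (∀ u, χ u = 0 ∨ χ u = 1 ∨ χ u = -1) → (∀ u ∉ S, χ u = 0) →
      S.card ≤ 8 * (S.filter fun u => χ u ≠ 0).card →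
      ∃ i, hdiscStar Q n / (20 * Real.log n) < |∑ u, appendOnes (queryMatrix Q) i u * χ u| := by
  set H := hdiscStar Q n with hHdef
  have hln := one_lt_log_of_three_le hn
  by_contra! hcon
  set r := ⌈8 * Real.log n⌉₊ with hr
  have hb : 0 ≤ H / (20 * Real.log n) := by positivity
  -- As `r ≤ 9 log n`, the right side is at most `9H/20 + 1`, which is below `H` for `H ≥ 2`.
  have h1 : H ≤ H / (20 * Real.log n) * r + 1 := by
    refine hdisc_le_of_coloring (by positivity) fun S hS => ?_
    refine exists_coloring_of_partial (abs_appendOnes_le Q) hb (fun S h2 hn => ?_) r S hS ?_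
    · exact hcon S h2 hn
    · exact (Nat.mul_le_mul_right _ hS).trans_lt (mul_seven_eighths_pow_lt hn)
  have h2 : (r : ℝ) ≤ 9 * Real.log n := by
    have := Nat.ceil_lt_add_one (by positivity : 0 ≤ 8 * Real.log n)
    linarith
  have h3 : H / (20 * Real.log n) * r ≤ 9 / 20 * H := by
    rw [div_mul_eq_mul_div, div_le_iff₀ (by positivity)]
    nlinarith
  linarith

/-! ### Reconstruction from private answers -/

/-- The decoder has to be measurable for privacy to apply to events about decoded bits. -/
theorem exists_measurable_nearest {β E : Type*} [Fintype β] [Nonempty β] [PseudoEMetricSpace E]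
    [MeasurableSpace E] [OpensMeasurableSpace E] (v : β → E) :
    ∃ D : E → β, (∀ s : Set β, MeasurableSet (D ⁻¹' s)) ∧
      ∀ a b, edist (v (D a)) a ≤ edist (v b) a := by
  classical
  set e := Fintype.equivFin β
  set g : ℕ → β := fun k => if h : k < Fintype.card β then e.symm ⟨k, h⟩ else Classical.arbitrary β
    with hg
  refine ⟨fun a => g (SimpleFunc.nearestPtInd (v ∘ g) (Fintype.card β) a), fun s => ?_,
    fun a b => ?_⟩
  · exact (SimpleFunc.nearestPtInd (v ∘ g) (Fintype.card β)).measurableSet_preimage (g ⁻¹' s)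
  · have h1 := SimpleFunc.edist_nearestPt_le (v ∘ g) a (k := (e b : ℕ)) 
      (N := Fintype.card β) (e b).2.le
    have h2 : g (e b) = b := by simp [hg]
    simpa [SimpleFunc.nearestPt, h2] using h1

variable {d : ℕ}

/-- Flip one bit. -/
def flip (b : Fin d → Bool) (i : Fin d) : Fin d → Bool := Function.update b i (!b i)

theorem flip_flip (b : Fin d → Bool) (i : Fin d) : flip (flip b i) i = b := by
  simp [flip]

/-- The bits in which two words differ. -/
def differ (b c : Fin d → Bool) : Finset (Fin d) := Finset.univ.filter fun i => b i ≠ c i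

/-- The bits of the input of a private algorithm cannot all be recovered. -/
theorem exists_reconstruction_error {R : Type*} [MeasurableSpace R]
    {M : Dataset U n → Measure R} (hM : ∀ x, IsProbabilityMeasure (M x))
    (hDP : IsDP (1 / 8) (1 / 8) M) (X : (Fin d → Bool) → Dataset U n)
    (hX : ∀ b i, Neighboring (X b) (X (flip b i))) {D : R → Fin d → Bool}
    (hD : ∀ s : Set (Fin d → Bool), MeasurableSet (D ⁻¹' s)) :
    ∃ b, (2 / 5 : ℝ) * d ≤ ∑ i, (M (X b)).real {a | D a i ≠ b i} := by
  set err : (Fin d → Bool) → Fin d → ℝ := fun b i => (M (X b)).real {a | D a i ≠ b i} with herr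
  have hmeas : ∀ (i : Fin d) (c : Bool), MeasurableSet {a | D a i ≠ c} := fun i c =>
    hD {b | b i ≠ c}
  have hexp : Real.exp (1 / 8) ≤ 8 / 7 := by
    have h1 := Real.add_one_le_exp (-(1 / 8 : ℝ))
    have h2 : Real.exp (1 / 8) * Real.exp (-(1 / 8)) = 1 := by rw [← Real.exp_add]; simp
    nlinarith [Real.exp_pos (1 / 8)]
  have hbit : ∀ b i, 1 - err b i ≤ 8 / 7 * err (flip b i) i + 1 / 8 := by
    intro b i
    have h1 := hDP _ _ (hX b i) {a | D a i ≠ flip b i i} (hmeas i _)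
    have hset : {a | D a i ≠ flip b i i} = {a | D a i ≠ b i}ᶜ := by
      ext a
      simp [flip]
    have h2 : (M (X b)).real {a | D a i ≠ flip b i i} = 1 - err b i := by
      rw [hset, probReal_compl_eq_one_sub (hmeas i _)]
    have h3 := ENNReal.toReal_mono (by finiteness) h1
    rw [ENNReal.toReal_add (by finiteness) (by finiteness), ENNReal.toReal_mul,
      ENNReal.toReal_ofReal (Real.exp_pos _).le, ENNReal.toReal_ofReal (by norm_num)] at h3
    change (M (X b)).real _ ≤ Real.exp (1 / 8) * err (flip b i) i + 1 / 8 at h3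
    rw [h2] at h3
    have h4 : 0 ≤ err (flip b i) i := measureReal_nonneg
    nlinarith
  -- Flipping bit `i` permutes the words, so averaging `hbit` gives a mean error of at least `(7/8)
  -- / (15/7) = 49/120 > 2/5`.
  have hsum : ∀ i, (2 / 5 : ℝ) * Fintype.card (Fin d → Bool) ≤ ∑ b, err b i := by
    intro i
    have h1 : ∑ b, (1 - err b i) ≤ ∑ b, (8 / 7 * err (flip b i) i + 1 / 8) :=
      Finset.sum_le_sum fun b _ => hbit b i
    have h2 : ∑ b, err (flip b i) i = ∑ b, err b i :=
      Function.Involutive.bijective (f := fun b : Fin d → Bool => flip b i)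
        (fun b => flip_flip b i) |>.sum_comp fun b => err b i
    rw [Finset.sum_sub_distrib, Finset.sum_add_distrib, ← Finset.mul_sum, h2] at h1
    simp only [Finset.sum_const, Finset.card_univ, nsmul_eq_mul] at h1
    linarith [(Nat.cast_nonneg (Fintype.card (Fin d → Bool)) : (0 : ℝ) ≤ _)]
  by_contra! hcon
  have h1 : ∑ b : Fin d → Bool, ∑ i, err b i < ∑ _b : Fin d → Bool, (2 / 5 : ℝ) * d :=
    Finset.sum_lt_sum_of_nonempty Finset.univ_nonempty fun b _ => hcon b
  rw [Finset.sum_comm] at h1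
  have h2 : ∑ _i : Fin d, (2 / 5 : ℝ) * Fintype.card (Fin d → Bool) ≤ ∑ i, ∑ b, err b i :=
    Finset.sum_le_sum fun i _ => hsum i
  simp only [Finset.sum_const, Finset.card_univ, nsmul_eq_mul, Fintype.card_fin] at h1 h2
  linarith

theorem continuous_maxError {m : ℕ} (Q : Fin m → BoolQuery U) (x : Dataset U n) :
    Continuous fun a : Fin m → ℝ => maxError Q a x := by
  unfold maxError
  fun_prop

theorem edist_queryValue {m : ℕ} (Q : Fin m → BoolQuery U) (a : Fin m → ℝ) (x : Dataset U n) :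
    edist (fun j => queryValue (Q j) x) a = ENNReal.ofReal (maxError Q a x) := by
  rw [edist_dist, dist_eq_norm]
  rfl

/-- Answers of a private algorithm to queries that separate the inputs `X b` are inaccurate. -/
theorem exists_error_of_separated {m : ℕ} {Q : Fin m → BoolQuery U} (hd : 0 < d)
    {M : Dataset U n → Measure (Fin m → ℝ)} (hM : ∀ x, IsProbabilityMeasure (M x))
    (hDP : IsDP (1 / 8) (1 / 8) M) (X : (Fin d → Bool) → Dataset U n)
    (hX : ∀ b i, Neighboring (X b) (X (flip b i))) {h : ℝ} (hh : 0 ≤ h)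
    (hsep : ∀ b b', 3 * d ≤ 16 * (differ b b').card →
      ∃ j, h < |queryValue (Q j) (X b) - queryValue (Q j) (X b')|) :
    ∃ x, ENNReal.ofReal (h / 10) ≤ ∫⁻ a, ENNReal.ofReal (maxError Q a x) ∂(M x) := by
  classical
  obtain ⟨D, hD, hnear⟩ := exists_measurable_nearest fun b : Fin d → Bool =>
    fun j => queryValue (Q j) (X b)
  obtain ⟨b, hb⟩ := exists_reconstruction_error hM hDP X hX hD
  have hMb := hM (X b)
  refine ⟨X b, ?_⟩
  set μ := M (X b) with hμ
  set E : Set (Fin m → ℝ) := {a | ENNReal.ofReal (h / 2) ≤ ENNReal.ofReal (maxError Q a (X b))}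
    with hE
  have hmE : Measurable fun a : Fin m → ℝ => ENNReal.ofReal (maxError Q a (X b)) :=
    (continuous_maxError Q (X b)).measurable.ennreal_ofReal
  have hEmeas : MeasurableSet E := measurableSet_le measurable_const hmE
  -- The decoded word is at least as close to `a` as the true one, so a separation above `h` forces
  -- an error of at least `h / 2`.
  have hfar : ∀ a, 3 * d ≤ 16 * (differ b (D a)).card → a ∈ E := by
    intro a ha
    obtain ⟨j, hj⟩ := hsep b (D a) ha
    have h1 := hnear a b
    rw [edist_queryValue, edist_queryValue] at h1
    have h0 : ∀ x : Dataset U n, 0 ≤ maxError Q a x := fun x => norm_nonneg _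
    rw [ENNReal.ofReal_le_ofReal_iff (h0 _)] at h1
    have h2 : |queryValue (Q j) (X b) - a j| ≤ maxError Q a (X b) :=
      norm_le_pi_norm (fun j => queryValue (Q j) (X b) - a j) j
    have h3 : |queryValue (Q j) (X (D a)) - a j| ≤ maxError Q a (X (D a)) :=
      norm_le_pi_norm (fun j => queryValue (Q j) (X (D a)) - a j) j
    have h4 := abs_sub_le (queryValue (Q j) (X b)) (a j) (queryValue (Q j) (X (D a)))
    rw [abs_sub_comm (a j)] at h4
    exact ENNReal.ofReal_le_ofReal (by linarith)
  have hmi : ∀ i, MeasurableSet {a | D a i ≠ b i} := fun i => hD {b' | b' i ≠ b i}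
  have hcount : ∑ i, μ {a | D a i ≠ b i} ≤ ENNReal.ofReal (3 * d / 16) + d * μ E := by
    calc ∑ i, μ {a | D a i ≠ b i}
        = ∫⁻ a, ∑ i, {a | D a i ≠ b i}.indicator 1 a ∂μ := by
          rw [lintegral_finsetSum _ fun i _ => measurable_one.indicator (hmi i)]
          exact Finset.sum_congr rfl fun i _ => (lintegral_indicator_one (hmi i)).symm
      _ ≤ ∫⁻ a, (ENNReal.ofReal (3 * d / 16) + d * E.indicator 1 a) ∂μ := by
          refine lintegral_mono fun a => ?_
          have h1 : ∑ i, {a | D a i ≠ b i}.indicator (1 : (Fin m → ℝ) → ℝ≥0∞) a =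
              ((differ b (D a)).card : ℝ≥0∞) := by
            rw [differ, Finset.card_filter]
            push_cast
            refine Finset.sum_congr rfl fun i _ => ?_
            simp only [Set.indicator_apply, Set.mem_ofPred_eq, Pi.one_apply]
            by_cases hi : D a i = b i
            · simp [hi]
            · rw [if_pos hi, if_pos fun h => hi h.symm]
          rw [h1]
          by_cases ha : 3 * d ≤ 16 * (differ b (D a)).card
          · rw [Set.indicator_of_mem (hfar a ha), Pi.one_apply, mul_one]
            refine le_trans ?_ le_add_self
            exact_mod_cast (Finset.card_le_univ _).trans (by simp)
          · refine le_trans ?_ le_self_add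
            rw [← ENNReal.ofReal_natCast]
            apply ENNReal.ofReal_le_ofReal
            push Not at ha
            have : (16 : ℝ) * (differ b (D a)).card < 3 * d := by exact_mod_cast ha
            linarith
      _ = _ := by
          rw [lintegral_add_left measurable_const, lintegral_const, measure_univ, mul_one,
            lintegral_const_mul _ (measurable_one.indicator hEmeas),
            lintegral_indicator_one hEmeas]
  -- `2/5 - 3/16 = 17/80 > 1/5`.
  have hp : (1 / 5 : ℝ) ≤ μ.real E := by
    have h1 := ENNReal.toReal_mono (by finiteness) hcount
    rw [ENNReal.toReal_sum fun i _ => by finiteness,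
      ENNReal.toReal_add (by finiteness) (by finiteness), ENNReal.toReal_mul,
      ENNReal.toReal_ofReal (by positivity), ENNReal.toReal_natCast] at h1
    change ∑ i, μ.real {a | D a i ≠ b i} ≤ 3 * d / 16 + d * μ.real E at h1
    have hd' : (0 : ℝ) < d := by exact_mod_cast hd
    have h2 : (2 / 5 : ℝ) * d ≤ 3 * d / 16 + d * μ.real E := hb.trans h1
    nlinarith
  have hp' : ENNReal.ofReal (1 / 5) ≤ μ E := by
    rw [← ENNReal.ofReal_toReal (measure_ne_top μ E)]
    exact ENNReal.ofReal_le_ofReal hp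
  calc ENNReal.ofReal (h / 10) = ENNReal.ofReal (h / 2) * ENNReal.ofReal (1 / 5) := by
        rw [← ENNReal.ofReal_mul (by positivity)]
        congr 1
        ring
    _ ≤ ENNReal.ofReal (h / 2) * μ E := by gcongr
    _ ≤ _ := mul_meas_ge_le_lintegral hmE _

/-! ### Datasets built from pairs of elements -/

/-- The dataset whose `i`-th entry is `f (i, b i)`, padded with `p`. -/
def pairDataset (f : Fin d × Bool → U) (p : U) (hdn : d ≤ n) (b : Fin d → Bool) : Dataset U n :=
  Function.extend (Fin.castLE hdn) (fun i => f (i, b i)) fun _ => p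

theorem pairDataset_castLE (f : Fin d × Bool → U) (p : U) (hdn : d ≤ n) (b : Fin d → Bool)
    (i : Fin d) : pairDataset f p hdn b (Fin.castLE hdn i) = f (i, b i) :=
  (Fin.castLE_injective hdn).extend_apply _ _ i

theorem pairDataset_of_notMem (f : Fin d × Bool → U) (p : U) (hdn : d ≤ n) (b : Fin d → Bool)
    {i : Fin n} (hi : ¬ ∃ k, Fin.castLE hdn k = i) : pairDataset f p hdn b i = p :=
  Function.extend_apply' _ _ i hi

theorem neighboring_pairDataset {f : Fin d × Bool → U} (hf : Function.Injective f) (p : U)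
    (hdn : d ≤ n) (b : Fin d → Bool) (i : Fin d) :
    Neighboring (pairDataset f p hdn b) (pairDataset f p hdn (flip b i)) := by
  refine ⟨Fin.castLE hdn i, ?_, fun j hj => ?_⟩
  · rw [pairDataset_castLE, pairDataset_castLE]
    intro h
    have := congrArg Prod.snd (hf h)
    simp [flip] at this
  · by_cases h : ∃ k, Fin.castLE hdn k = j
    · obtain ⟨k, rfl⟩ := h
      have hk : k ≠ i := fun h => hj (by rw [h])
      rw [pairDataset_castLE, pairDataset_castLE, flip, Function.update_of_ne hk]
    · rw [pairDataset_of_notMem _ _ _ _ h, pairDataset_of_notMem _ _ _ _ h]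

theorem queryValue_pairDataset_sub (f : Fin d × Bool → U) (p : U) (hdn : d ≤ n)
    (b b' : Fin d → Bool) (q : BoolQuery U) :
    queryValue q (pairDataset f p hdn b) - queryValue q (pairDataset f p hdn b') =
      (∑ i, (truth q (f (i, b i)) - truth q (f (i, b' i)))) / n := by
  rw [queryValue, queryValue, ← sub_div, ← Finset.sum_sub_distrib]
  congr 1
  symm
  refine Finset.sum_of_injOn (Fin.castLE hdn) (Fin.castLE_injective hdn).injOn
    (fun _ _ => Finset.mem_coe.2 (Finset.mem_univ _)) (fun i _ hi => ?_) fun i _ => ?_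
  · have h : ¬ ∃ k, Fin.castLE hdn k = i := fun ⟨k, hk⟩ => hi ⟨k, by simp, hk⟩
    rw [pairDataset_of_notMem _ _ _ _ h, pairDataset_of_notMem _ _ _ _ h, sub_self]
  · rw [pairDataset_castLE, pairDataset_castLE]

/-- The colouring that compares two words. -/
def pairColoring [DecidableEq U] (f : Fin d × Bool → U) (b b' : Fin d → Bool) (u : U) : ℤ :=
  ∑ i, ((if f (i, b i) = u then 1 else 0) - if f (i, b' i) = u then 1 else 0)

theorem sum_mul_pairColoring [Fintype U] [DecidableEq U] (f : Fin d × Bool → U)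
    (b b' : Fin d → Bool) (g : U → ℝ) :
    ∑ u, g u * pairColoring f b b' u = ∑ i, (g (f (i, b i)) - g (f (i, b' i))) := by
  simp only [pairColoring]
  push_cast
  simp_rw [Finset.mul_sum]
  rw [Finset.sum_comm]
  refine Finset.sum_congr rfl fun i _ => ?_
  simp [mul_sub]

theorem pairColoring_apply [DecidableEq U] {f : Fin d × Bool → U} (hf : Function.Injective f)
    (b b' : Fin d → Bool) (i : Fin d) (c : Bool) : pairColoring f b b' (f (i, c)) =
      (if b i = c then 1 else 0) - if b' i = c then 1 else 0 := by
  rw [pairColoring, Finset.sum_eq_single i]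
  · simp [hf.eq_iff]
  · intro k _ hk
    simp [hf.eq_iff, hk]
  · simp

theorem pairColoring_of_notMem [DecidableEq U] {f : Fin d × Bool → U} (b b' : Fin d → Bool)
    {u : U} (hu : ∀ k, f k ≠ u) : pairColoring f b b' u = 0 := by
  simp [pairColoring, hu]

/-- The discrepancy lower bound for private algorithms. -/
theorem exists_error_of_hdiscStar [Fintype U] {m : ℕ} {Q : Fin m → BoolQuery U}
    (hn : 3 ≤ n) (hH : 2 ≤ hdiscStar Q n) {M : Dataset U n → Measure (Fin m → ℝ)}
    (hM : ∀ x, IsProbabilityMeasure (M x)) (hDP : IsDP (1 / 8) (1 / 8) M) :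
    ∃ x, ENNReal.ofReal (1 / 200 * (hdiscStar Q n / (n * Real.log n))) ≤
      ∫⁻ a, ENNReal.ofReal (maxError Q a x) ∂(M x) := by
  classical
  obtain ⟨S, hS2, hSn, hrigid⟩ := exists_rigid_set hn hH
  set H := hdiscStar Q n
  have hln := one_lt_log_of_three_le hn
  have hn0 : (0 : ℝ) < n := by positivity
  set d := S.card / 2 with hd
  have hd0 : 0 < d := by omega
  have hdn : d ≤ n := by omega
  obtain ⟨φ⟩ : Nonempty (Fin d × Bool ↪ S) := by
    refine Function.Embedding.nonempty_of_card_le ?_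
    simp only [Fintype.card_prod, Fintype.card_fin, Fintype.card_bool, Fintype.card_coe]
    omega
  set f : Fin d × Bool → U := fun k => φ k with hf
  have hinj : Function.Injective f := Subtype.val_injective.comp φ.injective
  have hfS : ∀ k, f k ∈ S := fun k => (φ k).2
  set p : U := f (⟨0, hd0⟩, false)
  obtain ⟨x, hx⟩ := exists_error_of_separated (Q := Q) hd0 hM hDP (pairDataset f p hdn)
    (neighboring_pairDataset hinj p hdn) (h := H / (20 * Real.log n) / n) (by positivity) (by
      intro b b' hbb
      have hval : ∀ u, pairColoring f b b' u = 0 ∨ pairColoring f b b' u = 1 ∨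
          pairColoring f b b' u = -1 := by
        intro u
        by_cases hu : ∃ k, f k = u
        · obtain ⟨⟨i, c⟩, rfl⟩ := hu
          rw [pairColoring_apply hinj]
          split_ifs <;> simp
        · push Not at hu
          exact Or.inl (pairColoring_of_notMem b b' hu)
      have hsub : ((differ b b') ×ˢ (Finset.univ : Finset Bool)).image f ⊆
          S.filter fun u => pairColoring f b b' u ≠ 0 := by
        intro u hu
        obtain ⟨⟨i, c⟩, hic, rfl⟩ := Finset.mem_image.1 hu
        refine Finset.mem_filter.2 ⟨hfS _, ?_⟩
        have hi : b i ≠ b' i := by simpa [differ] using hic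
        rw [pairColoring_apply hinj]
        revert hi
        cases b i <;> cases b' i <;> cases c <;> simp
      have hcard := Finset.card_le_card hsub
      rw [Finset.card_image_of_injective _ hinj, Finset.card_product, Finset.card_univ,
        Fintype.card_bool] at hcard
      -- The support has at least `2 * 3d/16 = 3d/8` elements, and `S.card ≤ 2d + 1 ≤ 3d`, so it
      -- covers an eighth of `S`.
      obtain ⟨i, hi⟩ := hrigid (pairColoring f b b') hval
        (fun u hu => pairColoring_of_notMem b b' fun k hk => hu (hk ▸ hfS k)) (by omega)
      rw [sum_mul_pairColoring] at hi
      revert hi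
      refine Fin.lastCases ?_ (fun j => ?_) i
      -- Both datasets have the same size, so the row of ones cannot be the one with large
      -- discrepancy; a genuine query must be.
      · intro hi
        simp only [appendOnes, Matrix.of_apply, Fin.snoc_last, sub_self, Finset.sum_const_zero,
          abs_zero] at hi
        exact absurd hi (not_lt.2 (by positivity))
      · intro hi
        simp only [appendOnes, Matrix.of_apply, Fin.snoc_castSucc, queryMatrix] at hi
        refine ⟨j, ?_⟩
        rw [queryValue_pairDataset_sub, abs_div, Nat.abs_cast]
        gcongr)
  refine ⟨x, le_trans (le_of_eq ?_) hx⟩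
  congr 1
  field_simp
  ring

/-- The ratio between the lower bound and the error rate. -/
theorem div_eq_errorRate_mul {H : ℝ} (hH : 2 ≤ H) {N n m : ℕ} (hN : 2 ≤ N) (hn : 3 ≤ n)
    (hm : 1 ≤ m) {ε δ β : ℝ} (hε : 0 < ε) (hδ : 0 < δ) (hδ1 : δ < 1) (hβ : 0 < β) (hβ1 : β < 1) :
    H / n = errorRate H N n m ε δ β ^ (2 / 3 : ℝ) *
      (ε ^ 2 * H ^ 2 / (n * Real.log N * Real.log (1 / δ) *
        Real.log (m * Real.log n / β) ^ 2 * Real.log n ^ 2)) ^ (1 / 3 : ℝ) := by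
  have hln := one_lt_log_of_three_le hn
  have hn0 : (0 : ℝ) < n := by positivity
  have hL := log_rate_pos hn hm hβ hβ1
  have hD : 0 < Real.log (1 / δ) := Real.log_pos (by rw [lt_div_iff₀ hδ]; linarith)
  have hlN : 0 < Real.log N := Real.log_pos (by exact_mod_cast (by omega : 1 < N))
  have hF : errorRate H N n m ε δ β = Real.sqrt (H * Real.log N * Real.log (1 / δ)) *
    Real.log (m * Real.log n / β) * Real.log n / (ε * n) := rfl
  set L := Real.log (m * Real.log n / β)
  set D := Real.log (1 / δ)
  set lN := Real.log N
  have hF0 : 0 ≤ errorRate H N n m ε δ β := by rw [hF]; positivity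
  have h1 : errorRate H N n m ε δ β ^ (2 / 3 : ℝ) =
      (errorRate H N n m ε δ β ^ 2) ^ (1 / 3 : ℝ) := by
    rw [← Real.rpow_natCast _ 2, ← Real.rpow_mul hF0]
    norm_num
  have h2 : errorRate H N n m ε δ β ^ 2 * (ε ^ 2 * H ^ 2 / (n * lN * D * L ^ 2 *
      Real.log n ^ 2)) = (H / n) ^ 3 := by
    rw [hF, div_pow, mul_pow (Real.sqrt _ * L), mul_pow (Real.sqrt _),
      Real.sq_sqrt (by positivity)]
    field_simp
  rw [h1, ← Real.mul_rpow (by positivity) (by positivity), h2, ← Real.rpow_natCast _ 3,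
    ← Real.rpow_mul (by positivity)]
  norm_num

/-- Ensures `log N > 0`, so that the denominator in the competitiveness identity does not vanish. -/
theorem two_le_card_of_hdiscStar [Fintype U] {m : ℕ} {Q : Fin m → BoolQuery U} (hn : 3 ≤ n)
    (hH : 2 ≤ hdiscStar Q n) : 2 ≤ Fintype.card U := by
  classical
  obtain ⟨S, hS2, -, -⟩ := exists_rigid_set hn hH
  exact hS2.trans (Finset.card_le_univ S)

end

end OnlineRelease

theorem mainTheorem4 :
    -- the algorithm: privacy, and accuracy for adaptively chosen counting queries
    (∃ k : ℕ, ∀ δ₀ : ℝ, 0 < δ₀ → δ₀ < 1 → ∃ C : ℝ, 0 < C ∧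
      ∀ (U : Type u) [Fintype U] (n m : ℕ) (ε δ β : ℝ),
        3 ≤ n → 1 ≤ m → 0 < ε → ε ≤ 1 → 0 < δ → δ ≤ δ₀ → 0 < β → β < 1 →
        ∃ M : OnlineRelease.InteractiveAlgorithm U n,
          M.IsPrivate m ε δ ∧
          ∀ (A : OnlineRelease.AdaptiveAnalyst U) (x : OnlineRelease.Dataset U n),
            ENNReal.ofReal (1 - β) ≤
              OnlineRelease.trans M A m x
                {t | OnlineRelease.maxError (fun j => (t j).1) (fun j => (t j).2) x ≤
                  C * (1 + Real.log (Real.log n)) ^ k *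
                    OnlineRelease.errorRate (OnlineRelease.hdiscStar (fun j => (t j).1) n)
                      (Fintype.card U) n m ε δ β ^ (2 / 3 : ℝ)}) ∧
    -- competitiveness: the offline lower bound, and its ratio to the error of the algorithm
    (∃ c : ℝ, 0 < c ∧
      ∀ (U : Type u) [Fintype U] (n m : ℕ) (Q : Fin m → OnlineRelease.BoolQuery U),
        3 ≤ n → 1 ≤ m → 2 ≤ OnlineRelease.hdiscStar Q n →
        (∀ M : OnlineRelease.Dataset U n → MeasureTheory.Measure (Fin m → ℝ),
          (∀ x, MeasureTheory.IsProbabilityMeasure (M x)) →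
          OnlineRelease.IsDP (1 / 8) (1 / 8) M →
          ∃ x : OnlineRelease.Dataset U n,
            ENNReal.ofReal (c * (OnlineRelease.hdiscStar Q n / (n * Real.log n))) ≤
              ∫⁻ a, ENNReal.ofReal (OnlineRelease.maxError Q a x) ∂(M x)) ∧
        ∀ ε δ β : ℝ, 0 < ε → 0 < δ → δ < 1 → 0 < β → β < 1 →
          OnlineRelease.hdiscStar Q n / n =
            OnlineRelease.errorRate (OnlineRelease.hdiscStar Q n) (Fintype.card U) n m ε δ β
                ^ (2 / 3 : ℝ) *
              (ε ^ 2 * OnlineRelease.hdiscStar Q n ^ 2 /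
                (n * Real.log (Fintype.card U) * Real.log (1 / δ) *
                  Real.log (m * Real.log n / β) ^ 2 * Real.log n ^ 2)) ^ (1 / 3 : ℝ)) := by
  -- The exponent 0 suffices: the stage-dependent factor `k + 2` in the noise is already absorbed by
  -- the `log n` in the rate.
  refine ⟨⟨0, fun δ₀ hδ₀ hδ₀1 => ⟨OnlineRelease.rateConst δ₀,
    OnlineRelease.rateConst_pos hδ₀ hδ₀1, ?_⟩⟩, 1 / 200, by norm_num, ?_⟩
  · intro U _ n m ε δ β hn hm hε hε1 hδ hδδ₀ hβ hβ1
    simp only [pow_zero, mul_one]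
    rcases lt_or_ge (Fintype.card U) 2 with hU | hU
    · have : Subsingleton U := Fintype.card_le_one_iff_subsingleton.1 (by omega)
      refine OnlineRelease.exists_private_of_subsingleton hβ fun t => ?_
      have h0 : Real.log (Fintype.card U) = 0 := by
        interval_cases Fintype.card U <;> simp
      have h1 : OnlineRelease.errorRate (OnlineRelease.hdiscStar (fun j => (t j).1) n)
          (Fintype.card U) n m ε δ β = 0 := by
        simp [OnlineRelease.errorRate, h0]
      rw [h1]
      exact mul_nonneg (OnlineRelease.rateConst_pos hδ₀ hδ₀1).le (Real.rpow_nonneg le_rfl _)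
    · exact OnlineRelease.exists_private_of_two_le_card hU hδ₀1 hn hm hε hε1 hδ hδδ₀ hβ hβ1
  · intro U _ n m Q hn hm hH
    refine ⟨fun M hM hDP => OnlineRelease.exists_error_of_hdiscStar hn hH hM hDP, ?_⟩
    intro ε δ β hε hδ hδ1 hβ hβ1
    exact OnlineRelease.div_eq_errorRate_mul hH (OnlineRelease.two_le_card_of_hdiscStar hn hH)
      hn hm hε hδ hδ1 hβ hβ1
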